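/- **Proposition (Lie–Poisson integrator).** Let $G$ be a finite-dimensional real Lie group with Lie algebra $\mathfrak g$ (bracket of left-invariant vector fields). For $g\in G$ and $\xi\in\mathfrak g$ let $\langle \mathrm{Ad}^*_g\mu,\eta\rangle=\langle\mu,\mathrm{Ad}_g\eta\rangle$ and $\langle \mathrm{ad}^*_\xi\mu,\eta\rangle=\langle\mu,[\xi,\eta]\rangle$ on $\mathfrak g^*$. Let $\tau$ be a retraction map: a smooth diffeomorphism from an open neighbourhood of $0\in\mathfrak g$ onto an open neighbourhood of $e\in G$ with $\tau(0)=e$; put $\mathrm d_\xi\tau^{-1}(\eta)=\mathrm D\tau^{-1}(g)\cdot(\eta g)$ with $g=\tau(\xi)$. Let $H,H_1,\dots,H_N:T^*G\to\mathbb R$ be smooth and left $G$-invariant, i.e. $H(ag,ap)=H(g,p)$ for all $a\in G$ and $(g,p)\in T^*G$ (and likewise for each $H_i$), and set $h(g,\mu)=H(g,g\mu)$, $h_i(g,\mu)=H_i(g,g\mu)$ on $G\times\mathfrak g^*$. Let $W_1,\dots,W_N$ be real-valued processes (for instance independent Wiener processes), $\Delta t>0$, $K\ge 1$, $t_k=k\Delta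 t$, $T=K\Delta t$, and $\Delta W^i_k=W_i(t_k)-W_i(t_{k-1})$. Fix a sample point $\omega$. The midpoint Lie group method for a discrete curve $(g_0,\tilde g_1,\tilde\mu^1_1,\tilde\mu^2_1,g_1,\dots,\tilde g_K,\tilde\mu^1_K,\tilde\mu^2_K,g_K)$, with $g_k,\tilde g_k\in G$ and $\tilde\mu^1_k,\tilde\mu^2_k\in\mathfrak g^*$, is the following system. Let $\bar\mu_k=\frac12(\tilde\mu^1_k+\tilde\mu^2_k)$, $\Delta t\,\tilde\xi_k=\tau^{-1}(g_{k-1}^{-1}\tilde g_k)$, $\Delta t\,\xi_k=\tau^{-1}(\tilde g_k^{-1}g_k)$ (the arguments being required to lie in the domain of $\tau^{-1}$), $\tilde\nu^1_k=[\mathrm d_{\Delta t\tilde\xi_k}\tau^{-1}]^*\tilde\mu^1_k$ and $\tilde\nu^2_k=[\mathrm d_{\Delta t\xi_k}\tau^{-1}]^*\tilde\mu^2_k$. Then $$\tfrac1{\Delta t}\big(\mathrm{Ad}^*_{\tau(\Delta t\tilde\xi_k)}\tilde\nu^1_k-\tilde\nu^2_k\big)=\tilde g_k^{-1}\tfrac{\partial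 h}{\partial g}(\tilde g_k,\bar\mu_k)+\sum_{i=1}^N\tilde g_k^{-1}\tfrac{\partial h_i}{\partial g}(\tilde g_k,\bar\mu_k)\tfrac{\Delta W^i_k}{\Delta t}\quad(1\le k\le K),$$ $$\tfrac1{\Delta t}\big(\mathrm{Ad}^*_{\tau(\Delta t\xi_k)}\tilde\nu^2_k-\tilde\nu^1_{k+1}\big)=0\quad(1\le k\le K-1),$$ $$\tilde\xi_k=\xi_k=\tfrac12\tfrac{\partial h}{\partial\mu}(\tilde g_k,\bar\mu_k)+\tfrac12\sum_{i=1}^N\tfrac{\partial h_i}{\partial\mu}(\tilde g_k,\bar\mu_k)\tfrac{\Delta W^i_k}{\Delta t}\quad(1\le k\le K).$$ Its initial and final trivialized momenta are $\mu_0=\tilde\nu^1_1$ and $\mu_K=\mathrm{Ad}^*_{\tau(\Delta t\xi_K)}\tilde\nu^2_K$. Let $U\subset\mathfrak g^*$ be open (for instance $U=\mathfrak g^*$) and let $\mathcal F=\mathcal F^{\rm red}_{0,T}:U\to\mathfrak g^*$ be a reduced discrete flow of the method: there is a $C^1$ family of solutions of the method, parametrized by $\mu_0\in U$, with initial trivialized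 momentum $\mu_0$ and final trivialized momentum $\mathcal F(\mu_0)=\mu_K$. ($U$, the family and $\mathcal F$ may depend on $\omega$.) Then: 1. $\mathcal F$ is $C^1$ and preserves the Lie–Poisson bracket $\{f,g\}(\mu)=-\langle\mu,[\frac{\delta f}{\delta\mu},\frac{\delta g}{\delta\mu}]\rangle$: on $U$, $\{f\circ\mathcal F,g\circ\mathcal F\}=\{f,g\}\circ\mathcal F$ for all $C^1$ functions $f,g:\mathfrak g^*\to\mathbb R$ (in particular for all smooth ones). 2. For every coadjoint orbit $\mathcal O=\{\mathrm{Ad}^*_a\mu: a\in G\}$, $\mathcal F$ maps $U\cap\mathcal O$ into $\mathcal O$, the restriction is $C^1$ for the manifold structure of $\mathcal O$ as a homogeneous space of $G$, and it is symplectic for the Kirillov–Kostant–Souriau form $\omega_{\mathcal O}(\nu)(\mathrm{ad}^*_\xi\nu,\mathrm{ad}^*_\eta\nu)=-\langle\nu,[\xi,\eta]\rangle$: for $\nu\in U\cap\mathcal O$ the derivative $\mathrm D\mathcal F(\nu)$ maps $T_\nu\mathcal O=\{\mathrm{ad}^*_\xi\nu:\xi\in\mathfrak g\}$ into $T_{\mathcal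 F(\nu)}\mathcal O$, and $\omega_{\mathcal O}(\mathcal F(\nu))(\mathrm D\mathcal F(\nu)u,\mathrm D\mathcal F(\nu)v)=\omega_{\mathcal O}(\nu)(u,v)$ for all $u,v\in T_\nu\mathcal O$. -/

import Mathlib

open scoped Manifold ContDiff NNReal

noncomputable section

namespace LiePoisson

/-! Throughout, `G` is a finite-dimensional real Lie group modelled on the normed space `E`.
Its Lie algebra is `GroupLieAlgebra 𝓘(ℝ, E) G`, the tangent space at the identity; the vector space
underlying it is, by definition, `E`, which supplies the norm.  Accordingly elements of the Lie
algebra are written as elements of `E`, and elements of its dual as elements of `StrongDual ℝ E`. -/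

section LieGroupNotions

variable {E : Type*} [NormedAddCommGroup E] [NormedSpace ℝ E]
variable (G : Type*) [TopologicalSpace G] [ChartedSpace E G] [Group G]

/-- The bracket of the Lie algebra of `G` (bracket of left-invariant vector fields). -/
def bracket (ξ η : E) : E :=
  Bracket.bracket (L := GroupLieAlgebra 𝓘(ℝ, E) G) (M := GroupLieAlgebra 𝓘(ℝ, E) G) ξ η

theorem lieGroup_minSmoothness [LieGroup 𝓘(ℝ, E) ∞ G] :
    LieGroup 𝓘(ℝ, E) (minSmoothness ℝ 3) G := by
  rw [minSmoothness_of_isRCLikeNormedField]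
  exact LieGroup.of_le (n := ∞) ENat.LEInfty.out

section BracketFacts

variable [FiniteDimensional ℝ E] [LieGroup 𝓘(ℝ, E) ∞ G]

theorem bracket_add (ξ η ζ : E) :
    bracket G ξ (η + ζ) = bracket G ξ η + bracket G ξ ζ := by
  have : CompleteSpace E := FiniteDimensional.complete ℝ E
  have : LieGroup 𝓘(ℝ, E) (minSmoothness ℝ 3) G := lieGroup_minSmoothness G
  exact lie_add (L := GroupLieAlgebra 𝓘(ℝ, E) G) (M := GroupLieAlgebra 𝓘(ℝ, E) G) ξ η ζ

theorem bracket_smul (ξ : E) (c : ℝ) (η : E) :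
    bracket G ξ (c • η) = c • bracket G ξ η := by
  have : CompleteSpace E := FiniteDimensional.complete ℝ E
  have : LieGroup 𝓘(ℝ, E) (minSmoothness ℝ 3) G := lieGroup_minSmoothness G
  exact lie_smul (R := ℝ) (L := GroupLieAlgebra 𝓘(ℝ, E) G) (M := GroupLieAlgebra 𝓘(ℝ, E) G) c ξ η

theorem bracket_skew (ξ η : E) : -bracket G η ξ = bracket G ξ η := by
  have : CompleteSpace E := FiniteDimensional.complete ℝ E
  have : LieGroup 𝓘(ℝ, E) (minSmoothness ℝ 3) G := lieGroup_minSmoothness G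
  exact lie_skew (L := GroupLieAlgebra 𝓘(ℝ, E) G) ξ η

/-- `ad_ξ η = [ξ, η]`. -/
def ad (ξ : E) : E →L[ℝ] E :=
  LinearMap.toContinuousLinearMap
    { toFun := bracket G ξ
      map_add' := bracket_add G ξ
      map_smul' := bracket_smul G ξ }

@[simp] theorem ad_apply (ξ η : E) : ad G ξ η = bracket G ξ η := rfl

/-- `⟨ad*_ξ μ, η⟩ = ⟨μ, [ξ, η]⟩`. -/
def adStar (ξ : E) (μ : StrongDual ℝ E) : StrongDual ℝ E := μ.comp (ad G ξ)

@[simp] theorem adStar_apply (ξ η : E) (μ : StrongDual ℝ E) :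
    adStar G ξ μ η = μ (bracket G ξ η) := rfl

end BracketFacts

variable {G}

/-- The adjoint action: `Ad_a` is the derivative at the identity of `x ↦ a x a⁻¹`. -/
def Ad (a : G) : E →L[ℝ] E :=
  mfderiv 𝓘(ℝ, E) 𝓘(ℝ, E) (fun x : G => a * x * a⁻¹) 1

/-- The coadjoint action `⟨Ad*_a μ, η⟩ = ⟨μ, Ad_a η⟩`. -/
def AdStar (a : G) (μ : StrongDual ℝ E) : StrongDual ℝ E := μ.comp (Ad a)

/-- The vector `δf/δμ` of the Lie algebra, `⟨ν, δf/δμ⟩ = Df(μ) ν` for all `ν` in the dual. -/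
def variationalDerivative [FiniteDimensional ℝ E] (f : StrongDual ℝ E → ℝ)
    (μ : StrongDual ℝ E) : E :=
  (Module.evalEquiv ℝ E).symm
    ((fderiv ℝ f μ).toLinearMap ∘ₗ
      (LinearMap.toContinuousLinearMap : Module.Dual ℝ E ≃ₗ[ℝ] StrongDual ℝ E).toLinearMap)

theorem apply_variationalDerivative [FiniteDimensional ℝ E] (f : StrongDual ℝ E → ℝ)
    (μ ν : StrongDual ℝ E) : ν (variationalDerivative f μ) = fderiv ℝ f μ ν := by
  exact Module.apply_evalEquiv_symm_apply ℝ E (ν.toLinearMap : Module.Dual ℝ E) _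

end LieGroupNotions

section Poisson

variable {E : Type*} [NormedAddCommGroup E] [NormedSpace ℝ E] [FiniteDimensional ℝ E]
variable (G : Type*) [TopologicalSpace G] [ChartedSpace E G] [Group G]

/-- The Lie–Poisson bracket `{f, g}(μ) = -⟨μ, [δf/δμ, δg/δμ]⟩`. -/
def lpBracket (f g : StrongDual ℝ E → ℝ) (μ : StrongDual ℝ E) : ℝ :=
  -μ (bracket G (variationalDerivative f μ) (variationalDerivative g μ))

/-- `F` preserves the Lie–Poisson bracket over `U`. -/
def IsPoissonOn (F : StrongDual ℝ E → StrongDual ℝ E) (U : Set (StrongDual ℝ E)) : Prop :=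
  ∀ f g : StrongDual ℝ E → ℝ, ContDiff ℝ 1 f → ContDiff ℝ 1 g →
    ∀ μ ∈ U, lpBracket G (f ∘ F) (g ∘ F) μ = lpBracket G f g (F μ)

/-- The coadjoint orbit of `μ`. -/
def coadjointOrbit (μ : StrongDual ℝ E) : Set (StrongDual ℝ E) :=
  Set.range fun a : G => AdStar a μ

variable [LieGroup 𝓘(ℝ, E) ∞ G]

/-- The tangent space at `ν` of the coadjoint orbit through `ν`, as a subspace of the dual of
the Lie algebra: all vectors `ad*_ξ ν`. -/
def orbitTangent (ν : StrongDual ℝ E) : Set (StrongDual ℝ E) :=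
  Set.range fun ξ : E => adStar G ξ ν

/-- The Kirillov–Kostant–Souriau form at `ν`:
`ω(ν)(ad*_ξ ν, ad*_η ν) = -⟨ν, [ξ, η]⟩`, see `kksForm_adStar`. -/
def kksForm (ν : StrongDual ℝ E) (u v : orbitTangent G ν) : ℝ :=
  -ν (bracket G u.2.choose v.2.choose)

theorem kksForm_adStar (ν : StrongDual ℝ E) (ξ η : E) :
    kksForm G ν ⟨adStar G ξ ν, ξ, rfl⟩ ⟨adStar G η ν, η, rfl⟩ = -ν (bracket G ξ η) := by
  have h₁ : ∀ (u : orbitTangent G ν) (ζ : E), ν (bracket G u.2.choose ζ) = u.1 ζ :=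
    fun u ζ => congrArg (fun w : StrongDual ℝ E => w ζ) u.2.choose_spec
  have h₂ : ∀ (v : orbitTangent G ν) (ζ : E), ν (bracket G ζ v.2.choose) = -v.1 ζ := by
    intro v ζ
    rw [← bracket_skew, map_neg, h₁]
  have h := (h₁ ⟨adStar G ξ ν, ξ, rfl⟩ _).trans (h₂ ⟨adStar G η ν, η, rfl⟩ ξ)
  rw [adStar_apply, ← map_neg, bracket_skew] at h
  exact congrArg Neg.neg h

/-- `F`, defined on the open set `U`, restricts to a symplectic `C¹` map of the coadjoint orbit
of `μ` (with its Kirillov–Kostant–Souriau form) into itself.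

The orbit carries the manifold structure for which `a ↦ Ad*_a μ` is a surjective submersion from
`G`; a self-map of (an open part of) the orbit is therefore `C¹` precisely when it has local `C¹`
lifts to `G`.  This is the second clause. Its tangent map is the restriction of the derivative of
`F`. -/
structure IsSymplecticOnOrbit (F : StrongDual ℝ E → StrongDual ℝ E) (U : Set (StrongDual ℝ E))
    (μ : StrongDual ℝ E) : Prop where
  mapsTo : Set.MapsTo F (U ∩ coadjointOrbit G μ) (coadjointOrbit G μ)
  contMDiff : ∀ a : G, AdStar a μ ∈ U → ∃ θ : G → G, ContMDiffAt 𝓘(ℝ, E) 𝓘(ℝ, E) 1 θ a ∧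
    ∀ᶠ x in nhds a, F (AdStar x μ) = AdStar (θ x) μ
  tangent : ∀ ν ∈ U ∩ coadjointOrbit G μ, ∀ u ∈ orbitTangent G ν,
    fderiv ℝ F ν u ∈ orbitTangent G (F ν)
  pullback : ∀ (ν : StrongDual ℝ E) (hν : ν ∈ U ∩ coadjointOrbit G μ) (u v : orbitTangent G ν),
    kksForm G (F ν) ⟨fderiv ℝ F ν u, tangent ν hν u u.2⟩ ⟨fderiv ℝ F ν v, tangent ν hν v v.2⟩ =
      kksForm G ν u v

end Poisson

section Hamiltonians

variable {E : Type*} [NormedAddCommGroup E] [NormedSpace ℝ E]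
variable {G : Type*} [TopologicalSpace G] [ChartedSpace E G] [Group G]

variable (E G) in
/-- The cotangent bundle `T*G`; Mathlib gives it the manifold structure of the bundle of
continuous linear maps from the tangent bundle to the trivial line bundle. -/
abbrev CotangentBundle : Type _ :=
  Bundle.TotalSpace (E →L[ℝ] ℝ)
    (fun g : G => TangentSpace 𝓘(ℝ, E) g →L[ℝ] Bundle.Trivial G ℝ g)

/-- The cotangent lift of left translation, `a · (g, p) = (a g, a p)` with
`⟨a p, v⟩ = ⟨p, a⁻¹ v⟩` for `v` tangent at `a g`. -/
def cotangentLift (a : G) (z : CotangentBundle E G) : CotangentBundle E G :=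
  ⟨a * z.1, ContinuousLinearMap.comp (M₂ := E) z.2
    (mfderiv 𝓘(ℝ, E) 𝓘(ℝ, E) (fun x : G => a⁻¹ * x) (a * z.1))⟩

/-- The Hamiltonian `H` on `T*G` is left `G`-invariant. -/
def IsLeftInvariant (H : CotangentBundle E G → ℝ) : Prop :=
  ∀ (a : G) (z : CotangentBundle E G), H (cotangentLift a z) = H z

/-- The trivialized Hamiltonian `h(g, μ) = H(g, g μ)`. -/
def trivialized (H : CotangentBundle E G → ℝ) (g : G) (μ : StrongDual ℝ E) : ℝ :=
  H ⟨g, ContinuousLinearMap.comp (M₂ := E) μ (mfderiv 𝓘(ℝ, E) 𝓘(ℝ, E) (fun x : G => g⁻¹ * x) g)⟩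

/-- The covector `g⁻¹ ∂h/∂g (g, μ)`: the derivative of `h(·, μ)` at `g` applied to `g η`. -/
def gradGroup (h : G → StrongDual ℝ E → ℝ) (g : G) (μ : StrongDual ℝ E) : StrongDual ℝ E :=
  ContinuousLinearMap.comp (M₁ := E) (M₂ := E) (M₃ := ℝ)
    (mfderiv 𝓘(ℝ, E) 𝓘(ℝ, ℝ) (fun x : G => h x μ) g)
    (mfderiv 𝓘(ℝ, E) 𝓘(ℝ, E) (fun x : G => g * x) 1)

/-- The vector `∂h/∂μ (g, μ)` of the Lie algebra. -/
def gradMomentum [FiniteDimensional ℝ E] (h : G → StrongDual ℝ E → ℝ) (g : G)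
    (μ : StrongDual ℝ E) : E :=
  variationalDerivative (h g) μ

end Hamiltonians

section Scheme

variable {E : Type*} [NormedAddCommGroup E] [NormedSpace ℝ E]
variable {G : Type*} [TopologicalSpace G] [ChartedSpace E G] [Group G]

variable (E G) in
/-- A retraction map: a local diffeomorphism `τ` from a neighbourhood of `0` in the Lie algebra
onto a neighbourhood of the identity in `G`, with `τ 0 = e`. -/
structure Retraction extends PartialDiffeomorph 𝓘(ℝ, E) 𝓘(ℝ, E) E G ∞ where
  zero_mem : (0 : E) ∈ source
  map_zero : toFun 0 = 1

/-- The right trivialized derivative `d_ξ τ⁻¹ (η) = Dτ⁻¹(g) (η g)`, where `g = τ(ξ)`. -/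
def Retraction.dInv (τ : Retraction E G) (ξ : E) : E →L[ℝ] E :=
  ContinuousLinearMap.comp (M₁ := E) (M₂ := E) (M₃ := E)
    (mfderiv 𝓘(ℝ, E) 𝓘(ℝ, E) τ.invFun (τ.toFun ξ))
    (mfderiv 𝓘(ℝ, E) 𝓘(ℝ, E) (fun x : G => x * τ.toFun ξ) 1)

/-- The dual map `[d_ξ τ⁻¹]*`. -/
def Retraction.dInvStar (τ : Retraction E G) (ξ : E) (μ : StrongDual ℝ E) : StrongDual ℝ E :=
  μ.comp (τ.dInv ξ)

variable (E G) in
/-- A trivialized discrete curve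
`(g₀, g̃₁, μ̃¹₁, μ̃²₁, g₁, …, g̃_K, μ̃¹_K, μ̃²_K, g_K)`.
Only the entries `g k` with `0 ≤ k ≤ K`, and the others with `1 ≤ k ≤ K`, are used. -/
structure DiscreteCurve where
  g : ℕ → G
  gMid : ℕ → G
  mu₁ : ℕ → StrongDual ℝ E
  mu₂ : ℕ → StrongDual ℝ E

namespace DiscreteCurve

variable (c : DiscreteCurve E G) (τ : Retraction E G)

/-- The increment `g_{k-1}⁻¹ g̃_k`. -/
def inc₁ (k : ℕ) : G := (c.g (k - 1))⁻¹ * c.gMid k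

/-- The increment `g̃_k⁻¹ g_k`. -/
def inc₂ (k : ℕ) : G := (c.gMid k)⁻¹ * c.g k

/-- `[d_{τ⁻¹(g_{k-1}⁻¹ g̃_k)} τ⁻¹]* μ̃¹_k`. -/
def nu₁ (k : ℕ) : StrongDual ℝ E := τ.dInvStar (τ.invFun (c.inc₁ k)) (c.mu₁ k)

/-- `[d_{τ⁻¹(g̃_k⁻¹ g_k)} τ⁻¹]* μ̃²_k`. -/
def nu₂ (k : ℕ) : StrongDual ℝ E := τ.dInvStar (τ.invFun (c.inc₂ k)) (c.mu₂ k)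

/-- The midpoint momentum `(μ̃¹_k + μ̃²_k) / 2`. -/
def muMid (k : ℕ) : StrongDual ℝ E := (1 / 2 : ℝ) • (c.mu₁ k + c.mu₂ k)

/-- The initial trivialized momentum `μ₀ = g₀⁻¹ p₀`. -/
def initialMomentum : StrongDual ℝ E := c.nu₁ τ 1

/-- The final trivialized momentum `μ_K = g_K⁻¹ p_K`. -/
def finalMomentum (K : ℕ) : StrongDual ℝ E := AdStar (c.inc₂ K) (c.nu₂ τ K)

end DiscreteCurve

variable [FiniteDimensional ℝ E]

/-- The midpoint Lie group method with `K` steps of size `Δt`, for the Hamiltonian `H`, the noise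
Hamiltonians `H₁, …, H_N`, and the noise increments `ΔW k i`. -/
structure IsMidpointSolution {N : ℕ} (τ : Retraction E G) (H : CotangentBundle E G → ℝ)
    (Hn : Fin N → CotangentBundle E G → ℝ) (Δt : ℝ) (ΔW : ℕ → Fin N → ℝ) (K : ℕ)
    (c : DiscreteCurve E G) : Prop where
  inc₁_mem : ∀ k ∈ Finset.Icc 1 K, c.inc₁ k ∈ τ.target
  inc₂_mem : ∀ k ∈ Finset.Icc 1 K, c.inc₂ k ∈ τ.target
  momentum_mid : ∀ k ∈ Finset.Icc 1 K,
    (1 / Δt) • (AdStar (c.inc₁ k) (c.nu₁ τ k) - c.nu₂ τ k) =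
      gradGroup (trivialized H) (c.gMid k) (c.muMid k) +
        ∑ i, (ΔW k i / Δt) • gradGroup (trivialized (Hn i)) (c.gMid k) (c.muMid k)
  momentum_node : ∀ k ∈ Finset.Ico 1 K,
    (1 / Δt) • (AdStar (c.inc₂ k) (c.nu₂ τ k) - c.nu₁ τ (k + 1)) = 0
  velocity₁ : ∀ k ∈ Finset.Icc 1 K,
    (1 / Δt) • τ.invFun (c.inc₁ k) =
      (1 / 2 : ℝ) • gradMomentum (trivialized H) (c.gMid k) (c.muMid k) +
        (1 / 2 : ℝ) • ∑ i, (ΔW k i / Δt) •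
          gradMomentum (trivialized (Hn i)) (c.gMid k) (c.muMid k)
  velocity₂ : ∀ k ∈ Finset.Icc 1 K,
    (1 / Δt) • τ.invFun (c.inc₂ k) =
      (1 / 2 : ℝ) • gradMomentum (trivialized H) (c.gMid k) (c.muMid k) +
        (1 / 2 : ℝ) • ∑ i, (ΔW k i / Δt) •
          gradMomentum (trivialized (Hn i)) (c.gMid k) (c.muMid k)

/-- `F` is, over `U`, a reduced discrete flow `μ₀ ↦ μ_K` of the midpoint Lie group method: there is
a `C¹` family of solutions of the (implicit) method, parametrized by the initial trivialized
momentum `μ ∈ U`, whose final trivialized momentum is `F μ`. -/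
def IsReducedFlow {N : ℕ} (τ : Retraction E G) (H : CotangentBundle E G → ℝ)
    (Hn : Fin N → CotangentBundle E G → ℝ) (Δt : ℝ) (ΔW : ℕ → Fin N → ℝ) (K : ℕ)
    (U : Set (StrongDual ℝ E)) (F : StrongDual ℝ E → StrongDual ℝ E) : Prop :=
  ∃ c : StrongDual ℝ E → DiscreteCurve E G,
    (∀ μ ∈ U, IsMidpointSolution τ H Hn Δt ΔW K (c μ) ∧
      (c μ).initialMomentum τ = μ ∧ (c μ).finalMomentum τ K = F μ) ∧
    (∀ k ∈ Finset.Icc 0 K,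
      ContMDiffOn 𝓘(ℝ, StrongDual ℝ E) 𝓘(ℝ, E) 1 (fun μ => (c μ).g k) U) ∧
    (∀ k ∈ Finset.Icc 1 K,
      ContMDiffOn 𝓘(ℝ, StrongDual ℝ E) 𝓘(ℝ, E) 1 (fun μ => (c μ).gMid k) U ∧
      ContDiffOn ℝ 1 (fun μ => (c μ).mu₁ k) U ∧
      ContDiffOn ℝ 1 (fun μ => (c μ).mu₂ k) U)

/-- The increment `W_i(t_k) - W_i(t_{k-1})` along the grid `t_k = k Δt` (used for `k ≥ 1`). -/
def increment {Ω : Type*} {N : ℕ} (W : Fin N → ℝ≥0 → Ω → ℝ) (Δt : ℝ≥0) (w : Ω) (k : ℕ)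
    (i : Fin N) : ℝ :=
  W i (k * Δt) w - W i ((k - 1 : ℕ) * Δt) w

end Scheme

end LiePoisson

end

/-! Left invariance makes each trivialized Hamiltonian independent of the group variable, so the
forces vanish, and the two velocity equations force equal half-steps `τ X`. One step is therefore `ν
↦ Ad*_{σ(X)} ν` with `σ = τ²`, so `F` moves every momentum along its own coadjoint orbit. With `R`
the right-trivialized derivative of `σ`, `M` the midpoint momentum and `S` the reduced Hamiltonian
increment, the scheme becomes `2 M = ν ∘ R(X)` and `2 X = DS(M)`.

These are generating-function relations. A tangent vector `ad*_ξ ν` in direction `u` is carried to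
one with generator `ξ + R(X' u)`, up to an adjoint rotation. Differentiating the first relation and
antisymmetrizing, the Maurer–Cartan equation `fderiv_rightDeriv_sub` supplies the bracket of the two
`R`-terms. The change of the pairing is then `2 (⟨M' u, X' v⟩ - ⟨M' v, X' u⟩)`, which vanishes
because `D²S` is symmetric. This is `pairing_step`; `exists_hasFDerivAt_nodeMomentum` iterates it.
All derivatives are taken in the initial momentum, so no step has to be a function of the momentum
at the preceding node.

The Poisson property follows by linear algebra. Tangent spaces along one orbit have equal dimension,
so `DF` is an isomorphism between them, and the transpose of a symplectic isomorphism preserves the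
pairing (`IsOrbitSymplectic.apply_bracket_transpose`).

The Lie-theoretic inputs all come from the second derivative of the multiplication in a single chart
at the identity. -/

noncomputable section

namespace LiePoisson

/-! ### Calculus in the chart at the identity -/

section Chart

variable {E : Type*} [NormedAddCommGroup E] [NormedSpace ℝ E]
variable {G : Type*} [TopologicalSpace G] [ChartedSpace E G] [Group G]
variable {V : Type*} [NormedAddCommGroup V] [NormedSpace ℝ V]

/-- The preferred chart at the identity. -/
def chart (x : G) : E := extChartAt 𝓘(ℝ, E) (1 : G) x

variable (G) in
/-- The inverse of the preferred chart at the identity. -/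
def chartInv (y : E) : G := (extChartAt 𝓘(ℝ, E) (1 : G)).symm y

variable (E G) in
/-- The identity in the preferred chart. -/
def origin : E := chart (1 : G)

@[simp] theorem chartInv_origin : chartInv G (origin E G) = 1 := by
  simp [chartInv, origin, chart]

theorem chart_one : chart (1 : G) = origin E G := rfl

theorem eventually_chartInv_chart {x : G} (hx : x = 1) :
    ∀ᶠ z in nhds x, chartInv G (chart (E := E) z) = z := by
  subst hx
  filter_upwards [extChartAt_source_mem_nhds (I := 𝓘(ℝ, E)) (1 : G)] with z hz
  exact (extChartAt 𝓘(ℝ, E) (1 : G)).left_inv hz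

theorem eventually_chart_chartInv :
    ∀ᶠ y in nhds (origin E G), chart (chartInv G y) = y := by
  filter_upwards [extChartAt_target_mem_nhds (I := 𝓘(ℝ, E)) (1 : G)] with z hz
  exact (extChartAt 𝓘(ℝ, E) (1 : G)).right_inv hz

theorem contMDiffAt_chart {n : ℕ∞ω} {x : G} (hx : x = 1) :
    ContMDiffAt 𝓘(ℝ, E) 𝓘(ℝ, E) n (chart : G → E) x := by
  subst hx
  exact contMDiffAt_extChartAt

/-- The manifold derivative is read in the chart preferred at the image point. The value is `1` only
propositionally in the applications, such as `f x * (f x)⁻¹`, hence the hypothesis `h1`. -/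
theorem hasMFDerivAt_of_chart {g : V → G} {y : V} {g' : V →L[ℝ] E} (hg : ContinuousAt g y)
    (h1 : g y = 1) (h : HasFDerivAt (fun z => chart (g z)) g' y) :
    HasMFDerivAt 𝓘(ℝ, V) 𝓘(ℝ, E) g y g' := by
  refine ⟨hg, ?_⟩
  have : writtenInExtChartAt 𝓘(ℝ, V) 𝓘(ℝ, E) y g = fun z => chart (g z) := by
    ext z
    change extChartAt 𝓘(ℝ, E) (g y) (g z) = extChartAt 𝓘(ℝ, E) (1 : G) (g z)
    rw [h1]
  rw [this]
  exact h.hasFDerivWithinAt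

theorem mfderiv_eq_fderiv_chart {g : V → G} {y : V}
    (hg : ContMDiffAt 𝓘(ℝ, V) 𝓘(ℝ, E) 1 g y) (h1 : g y = 1) :
    (mfderiv 𝓘(ℝ, V) 𝓘(ℝ, E) g y : V →L[ℝ] E) = fderiv ℝ (fun z => chart (E := E) (g z)) y := by
  have h : ContMDiffAt 𝓘(ℝ, V) 𝓘(ℝ, E) 1 (fun z => (chart (g z) : E)) y :=
    (contMDiffAt_chart h1).comp y hg
  exact (hasMFDerivAt_of_chart hg.continuousAt h1
    (h.contDiffAt.differentiableAt one_ne_zero).hasFDerivAt).mfderiv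

theorem hasMFDerivAt_of_chart_of_chart {g : G → G} {g' : E →L[ℝ] E} (hg : ContinuousAt g 1)
    (h1 : g 1 = 1) (h : HasFDerivAt (fun z => chart (g (chartInv G z))) g' (origin E G)) :
    HasMFDerivAt 𝓘(ℝ, E) 𝓘(ℝ, E) g 1 g' := by
  refine ⟨hg, ?_⟩
  have : writtenInExtChartAt 𝓘(ℝ, E) 𝓘(ℝ, E) 1 g = fun z => chart (g (chartInv G z)) := by
    ext z
    simp [writtenInExtChartAt, chart, chartInv, h1]
  rw [this]
  exact h.hasFDerivWithinAt

variable [LieGroup 𝓘(ℝ, E) ∞ G]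

variable (E G) in
theorem contMDiffAt_chartInv : ContMDiffAt 𝓘(ℝ, E) 𝓘(ℝ, E) ∞ (chartInv G) (origin E G) :=
  have : IsManifold 𝓘(ℝ, E) ∞ G := inferInstance
  (contMDiffOn_extChartAt_symm (1 : G)).contMDiffAt
    (extChartAt_target_mem_nhds (I := 𝓘(ℝ, E)) (1 : G))

theorem mfderiv_eq_fderiv_chart_chartInv {g : G → G}
    (hg : ContMDiffAt 𝓘(ℝ, E) 𝓘(ℝ, E) 1 g 1) (h1 : g 1 = 1) :
    (mfderiv 𝓘(ℝ, E) 𝓘(ℝ, E) g 1 : E →L[ℝ] E) =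
      fderiv ℝ (fun z => chart (E := E) (g (chartInv G z))) (origin E G) := by
  have h : ContMDiffAt 𝓘(ℝ, E) 𝓘(ℝ, E) 1 (fun z => (chart (g (chartInv G z)) : E))
      (origin E G) := by
    exact ContMDiffAt.comp (g := chart) (f := fun z => g (chartInv G z)) _
      (contMDiffAt_chart (by simp [h1]))
      (ContMDiffAt.comp (g := g) (f := chartInv G) _ (by simpa using hg)
        ((contMDiffAt_chartInv E G).of_le ENat.LEInfty.out))
  exact (hasMFDerivAt_of_chart_of_chart hg.continuousAt h1
    (h.contDiffAt.differentiableAt one_ne_zero).hasFDerivAt).mfderiv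

variable (E G) in
/-- The multiplication in the preferred chart at the identity. -/
def localMul (p : E × E) : E := chart (chartInv G p.1 * chartInv G p.2)

variable (E G) in
theorem contDiffAt_localMul : ContDiffAt ℝ ∞ (localMul E G) (origin E G, origin E G) := by
  rw [← contMDiffAt_iff_contDiffAt]
  have h1 : ContMDiffAt 𝓘(ℝ, E × E) 𝓘(ℝ, E) ∞ (fun p : E × E => chartInv G p.1)
      (origin E G, origin E G) :=
    ContMDiffAt.comp (x := ((origin E G, origin E G) : E × E)) (g := chartInv G)
      (f := (Prod.fst : E × E → E)) (contMDiffAt_chartInv E G)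
      contDiffAt_fst.contMDiffAt
  have h2 : ContMDiffAt 𝓘(ℝ, E × E) 𝓘(ℝ, E) ∞ (fun p : E × E => chartInv G p.2)
      (origin E G, origin E G) :=
    ContMDiffAt.comp (x := ((origin E G, origin E G) : E × E)) (g := chartInv G)
      (f := (Prod.snd : E × E → E)) (contMDiffAt_chartInv E G)
      contDiffAt_snd.contMDiffAt
  exact (contMDiffAt_chart (by simp)).comp _ (h1.mul h2)

omit [LieGroup 𝓘(ℝ, E) ∞ G] in
theorem localMul_chart {x y : G} (hx : chartInv G (chart (E := E) x) = x)
    (hy : chartInv G (chart (E := E) y) = y) :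
    localMul E G (chart x, chart y) = chart (x * y) := by
  simp only [localMul, hx, hy]

variable (E G) in
/-- The second derivative at the identity of the multiplication, in the preferred chart. -/
def mulHessian : E × E →L[ℝ] E × E →L[ℝ] E :=
  fderiv ℝ (fderiv ℝ (localMul E G)) (origin E G, origin E G)

theorem mulHessian_symm (u v : E × E) : mulHessian E G u v = mulHessian E G v u :=
  (contDiffAt_localMul E G).isSymmSndFDerivAt
    (by rw [minSmoothness_of_isRCLikeNormedField]; exact ENat.LEInfty.out) u v

theorem hasFDerivAt_fderiv_localMul :
    HasFDerivAt (fderiv ℝ (localMul E G)) (mulHessian E G) (origin E G, origin E G) :=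
  (((contDiffAt_localMul E G).fderiv_right (m := 1)
    (by rw [one_add_one_eq_two]; exact ENat.LEInfty.out)).differentiableAt
    one_ne_zero).hasFDerivAt

variable (E G) in
theorem eventually_differentiableAt_localMul :
    ∀ᶠ p in nhds (origin E G, origin E G), DifferentiableAt ℝ (localMul E G) p := by
  filter_upwards [((contDiffAt_localMul E G).of_le (m := 1)
    ENat.LEInfty.out).eventually (by simp)] with p hp
  exact hp.differentiableAt one_ne_zero

theorem fderiv_localMul_inl (η : E) :
    fderiv ℝ (localMul E G) (origin E G, origin E G) (η, 0) = η := by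
  have h := (eventually_differentiableAt_localMul E G).self_of_nhds.hasFDerivAt
  have h2 : HasFDerivAt (localMul E G ∘ fun z => (z, origin E G))
      ((fderiv ℝ (localMul E G) (origin E G, origin E G)).comp
        ((ContinuousLinearMap.id ℝ E).prod 0)) (origin E G) :=
    HasFDerivAt.comp (origin E G) h
      ((hasFDerivAt_id (origin E G)).prodMk (hasFDerivAt_const (origin E G) (origin E G)))
  have h3 : (localMul E G ∘ fun z => (z, origin E G)) =ᶠ[nhds (origin E G)] id := by
    filter_upwards [eventually_chart_chartInv (E := E) (G := G)] with z hz
    simp [localMul, hz]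
  have := h2.unique ((hasFDerivAt_id _).congr_of_eventuallyEq h3)
  simpa using congrArg (fun L => L η) this

end Chart

/-! ### The Lie bracket as a second derivative of the multiplication -/

section ChartBracket

variable {E : Type*} [NormedAddCommGroup E] [NormedSpace ℝ E]
variable {G : Type*} [TopologicalSpace G] [ChartedSpace E G] [Group G] [LieGroup 𝓘(ℝ, E) ∞ G]

variable {V : Type*} [NormedAddCommGroup V] [NormedSpace ℝ V]

theorem hasFDerivAt_comp_prodMk {m : E × E → E} {a b : V → E} {a' b' : V →L[ℝ] E} {x : V}
    (hm : DifferentiableAt ℝ m (a x, b x)) (ha : HasFDerivAt a a' x) (hb : HasFDerivAt b b' x) :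
    HasFDerivAt (fun y => m (a y, b y)) ((fderiv ℝ m (a x, b x)).comp (a'.prod b')) x :=
  HasFDerivAt.comp (g := m) (f := fun y => (a y, b y)) x hm.hasFDerivAt (ha.prodMk hb)

/-- The product rule behind the bracket formula, the Maurer–Cartan equation and the derivative of
`Ad`: each differentiates an expression in first derivatives of the multiplication once more at the
identity. -/
theorem hasFDerivAt_fderiv_localMul_apply {a b : V → E} {c : V → E × E} {a' b' : V →L[ℝ] E}
    {c' : V →L[ℝ] E × E} {x : V} (ha : HasFDerivAt a a' x) (hb : HasFDerivAt b b' x)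
    (hc : HasFDerivAt c c' x) (hax : a x = origin E G) (hbx : b x = origin E G) :
    HasFDerivAt (fun y => fderiv ℝ (localMul E G) (a y, b y) (c y))
      ((fderiv ℝ (localMul E G) (origin E G, origin E G)).comp c' +
        ((mulHessian E G).comp (a'.prod b')).flip (c x)) x := by
  have h : HasFDerivAt (fun y => fderiv ℝ (localMul E G) (a y, b y))
      ((mulHessian E G).comp (a'.prod b')) x :=
    HasFDerivAt.comp (g := fderiv ℝ (localMul E G)) (f := fun y => (a y, b y)) x
      (by rw [hax, hbx]; exact hasFDerivAt_fderiv_localMul) (ha.prodMk hb)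
  simpa only [hax, hbx] using h.clm_apply hc

theorem fderiv_localMul_inr (η : E) :
    fderiv ℝ (localMul E G) (origin E G, origin E G) (0, η) = η := by
  have h := hasFDerivAt_comp_prodMk (a := fun _ => origin E G) (b := fun z => z)
    (x := origin E G) (eventually_differentiableAt_localMul E G).self_of_nhds
    (hasFDerivAt_const (origin E G) (origin E G)) (hasFDerivAt_id (origin E G))
  have h3 : (fun z => localMul E G (origin E G, z)) =ᶠ[nhds (origin E G)] id := by
    filter_upwards [eventually_chart_chartInv (E := E) (G := G)] with z hz
    simp [localMul, hz]
  have := h.unique ((hasFDerivAt_id _).congr_of_eventuallyEq h3)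
  simpa using congrArg (fun L : E →L[ℝ] E => L η) this

variable (E G) in
theorem hasMFDerivAt_chartInv :
    HasMFDerivAt 𝓘(ℝ, E) 𝓘(ℝ, E) (chartInv G) (origin E G) (ContinuousLinearMap.id ℝ E) := by
  refine hasMFDerivAt_of_chart (contMDiffAt_chartInv E G).continuousAt chartInv_origin ?_
  exact (hasFDerivAt_id _).congr_of_eventuallyEq eventually_chart_chartInv

theorem mdifferentiableAt_mul_left (g x : G) :
    MDifferentiableAt 𝓘(ℝ, E) 𝓘(ℝ, E) (fun y : G => g * y) x :=
  (contMDiff_mul_left (I := 𝓘(ℝ, E)) (n := ∞) (a := g)).contMDiffAt.mdifferentiableAt (by simp)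

theorem mdifferentiableAt_mul_right (g x : G) :
    MDifferentiableAt 𝓘(ℝ, E) 𝓘(ℝ, E) (fun y : G => y * g) x :=
  (contMDiff_mul_right (I := 𝓘(ℝ, E)) (n := ∞) (a := g)).contMDiffAt.mdifferentiableAt (by simp)

-- Left translation by `y` reads `z ↦ localMul (y, z)` in the chart, so the left-invariant field is
-- a partial derivative in the second factor.
variable (E G) in
theorem eventually_mpullbackWithin_mulInvariantVectorField (ξ : E) :
    ∀ᶠ y in nhds (origin E G),
      VectorField.mpullbackWithin 𝓘(ℝ, E) 𝓘(ℝ, E) (extChartAt 𝓘(ℝ, E) (1 : G)).symm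
        (mulInvariantVectorField (I := 𝓘(ℝ, E)) (G := G) ξ) (Set.range 𝓘(ℝ, E)) y =
      fderiv ℝ (localMul E G) (y, origin E G) (0, ξ) := by
  have : IsManifold 𝓘(ℝ, E) ∞ G := inferInstance
  have : IsManifold 𝓘(ℝ, E) 1 G := IsManifold.of_le (n := ∞) ENat.LEInfty.out
  have hd : ∀ᶠ y in nhds (origin E G), DifferentiableAt ℝ (localMul E G) (y, origin E G) :=
    (Continuous.continuousAt (f := fun y : E => (y, origin E G)) (by fun_prop)).eventually
      (eventually_differentiableAt_localMul E G)
  filter_upwards [extChartAt_target_mem_nhds (I := 𝓘(ℝ, E)) (1 : G), hd] with y hy hdy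
  rw [VectorField.mpullbackWithin_apply]
  have h1 := mfderiv_extChartAt_comp_mfderivWithin_extChartAt_symm (I := 𝓘(ℝ, E)) hy
  have h2 := mfderivWithin_extChartAt_symm_comp_mfderiv_extChartAt (I := 𝓘(ℝ, E)) hy
  -- The pullback inverts the derivative of the inverse chart; that inverse is the derivative of the
  -- chart.
  rw [ContinuousLinearMap.inverse_eq h2 h1]
  have h3 : HasMFDerivAt 𝓘(ℝ, E) 𝓘(ℝ, E) (fun z => chartInv G y * chartInv G z) (origin E G)
      (mfderiv 𝓘(ℝ, E) 𝓘(ℝ, E) (fun x : G => chartInv G y * x) 1) := by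
    have := HasMFDerivAt.comp (origin E G) (g := fun x : G => chartInv G y * x)
      (mdifferentiableAt_mul_left (chartInv G y) (chartInv G (origin E G))).hasMFDerivAt
      (hasMFDerivAt_chartInv E G)
    rw [chartInv_origin] at this
    exact this
  have hs : chartInv G y ∈ (extChartAt 𝓘(ℝ, E) (1 : G)).source :=
    (extChartAt 𝓘(ℝ, E) (1 : G)).map_target hy
  rw [extChartAt_source] at hs
  have h4 : HasMFDerivAt 𝓘(ℝ, E) 𝓘(ℝ, E) (chart : G → E)
      (chartInv G y * chartInv G (origin E G))
      (mfderiv 𝓘(ℝ, E) 𝓘(ℝ, E) (chart : G → E) (chartInv G y)) := by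
    rw [chartInv_origin, mul_one]
    exact (mdifferentiableAt_extChartAt hs).hasMFDerivAt
  obtain ⟨L, hL, h5⟩ : ∃ L : E →L[ℝ] E, L ξ = mfderiv 𝓘(ℝ, E) 𝓘(ℝ, E) (chart : G → E)
      (chartInv G y) (mfderiv 𝓘(ℝ, E) 𝓘(ℝ, E) (fun x : G => chartInv G y * x) 1 ξ) ∧
      HasFDerivAt (fun z => localMul E G (y, z)) L (origin E G) :=
    ⟨_, rfl, (HasMFDerivAt.comp (origin E G) h4 h3).hasFDerivAt⟩
  have h6 := hasFDerivAt_comp_prodMk (a := fun _ => y) (b := fun z => z) (x := origin E G) hdy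
    (hasFDerivAt_const y (origin E G))
    (hasFDerivAt_id (origin E G))
  refine hL.symm.trans ?_
  rw [h5.unique h6]
  simp

/-- In the chart this is the commutator of two vector fields on `E`, and the derivative of each at
the origin is a mixed second derivative of the multiplication. -/
theorem bracket_eq_mulHessian (ξ η : E) :
    bracket G ξ η = mulHessian E G (ξ, 0) (0, η) - mulHessian E G (η, 0) (0, ξ) := by
  have : IsManifold 𝓘(ℝ, E) ∞ G := inferInstance
  have : IsManifold 𝓘(ℝ, E) 1 G := IsManifold.of_le (n := ∞) ENat.LEInfty.out
  have key : ∀ {v : E → E} (ξ : E),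
      (∀ᶠ y in nhds (origin E G), v y = fderiv ℝ (localMul E G) (y, origin E G) (0, ξ)) →
      v (origin E G) = ξ ∧ ∀ δ, fderiv ℝ v (origin E G) δ = mulHessian E G (δ, 0) (0, ξ) := by
    intro v ξ hv
    refine ⟨by rw [hv.self_of_nhds, fderiv_localMul_inr], fun δ => ?_⟩
    have h := hasFDerivAt_fderiv_localMul_apply (G := G) (hasFDerivAt_id (origin E G))
      (hasFDerivAt_const (origin E G) (origin E G))
      (hasFDerivAt_const ((0 : E), ξ) (origin E G)) rfl rfl
    rw [(h.congr_of_eventuallyEq hv).fderiv]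
    simp
  change VectorField.mlieBracketWithin 𝓘(ℝ, E) _ _ Set.univ (1 : G) = _
  rw [VectorField.mlieBracketWithin_apply, mfderiv_extChartAt_self]
  have hs : ((extChartAt 𝓘(ℝ, E) (1 : G)).symm ⁻¹' Set.univ ∩ Set.range 𝓘(ℝ, E)) =
      Set.univ := by simp
  rw [hs]
  refine (congrFun (congrArg _ ContinuousLinearMap.inverse_id) _).trans ?_
  obtain ⟨h1, h2⟩ := key ξ (eventually_mpullbackWithin_mulInvariantVectorField E G ξ)
  obtain ⟨h3, h4⟩ := key η (eventually_mpullbackWithin_mulInvariantVectorField E G η)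
  rw [← h2, ← h4]
  refine Eq.trans (congrFun (VectorField.lieBracketWithin_univ (𝕜 := ℝ) (E := E)) _) ?_
  change _ - _ = _ - _
  refine congrArg₂ _ (congrArg _ h1) (congrArg _ h3)

end ChartBracket

/-! ### Right-trivialized derivatives and the Maurer–Cartan equation -/

section RightDerivative

variable {E : Type*} [NormedAddCommGroup E] [NormedSpace ℝ E]
variable {G : Type*} [TopologicalSpace G] [ChartedSpace E G] [Group G]
variable {V : Type*} [NormedAddCommGroup V] [NormedSpace ℝ V]

/-- The right-trivialized derivative of a map into a Lie group. -/
def rightDeriv (f : V → G) (x : V) : V →L[ℝ] E :=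
  mfderiv 𝓘(ℝ, V) 𝓘(ℝ, E) (fun z => f z * (f x)⁻¹) x

variable [LieGroup 𝓘(ℝ, E) ∞ G]

theorem contMDiffAt_mul_const {n : ℕ} {f : V → G} {x : V}
    (hf : ContMDiffAt 𝓘(ℝ, V) 𝓘(ℝ, E) n f x) (b : G) :
    ContMDiffAt 𝓘(ℝ, V) 𝓘(ℝ, E) n (fun z => f z * b) x :=
  have : LieGroup 𝓘(ℝ, E) n G := LieGroup.of_le (n := ∞) ENat.LEInfty.out
  hf.mul contMDiffAt_const

theorem contDiffAt_chart_mul_inv {n : ℕ} {f : V → G} {x : V}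
    (hf : ContMDiffAt 𝓘(ℝ, V) 𝓘(ℝ, E) n f x) :
    ContDiffAt ℝ n (fun z => chart (E := E) (f z * (f x)⁻¹)) x :=
  (ContMDiffAt.comp (g := (chart : G → E)) x (contMDiffAt_chart (mul_inv_cancel (f x)))
    (contMDiffAt_mul_const hf _)).contDiffAt

theorem rightDeriv_eq_fderiv {f : V → G} {x : V} (hf : ContMDiffAt 𝓘(ℝ, V) 𝓘(ℝ, E) 1 f x) :
    (rightDeriv f x : V →L[ℝ] E) = fderiv ℝ (fun z => chart (E := E) (f z * (f x)⁻¹)) x :=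
  mfderiv_eq_fderiv_chart (contMDiffAt_mul_const (n := 1) (by exact_mod_cast hf) _)
    (mul_inv_cancel _)

/-- On the diagonal, the partial derivative of this function in its first argument is `rightDeriv
f`. Joint smoothness is needed because the base point varies as well. -/
theorem contDiffAt_chart_mul_inv_prod {f : V → G} {x : V}
    (hf : ContMDiffAt 𝓘(ℝ, V) 𝓘(ℝ, E) 2 f x) :
    ContDiffAt ℝ 2 (fun p : V × V => chart (E := E) (f p.1 * (f p.2)⁻¹)) (x, x) := by
  have : LieGroup 𝓘(ℝ, E) 2 G := LieGroup.of_le (n := ∞) ENat.LEInfty.out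
  have h1 : ContMDiffAt 𝓘(ℝ, V × V) 𝓘(ℝ, E) 2 (fun p : V × V => f p.1) (x, x) :=
    ContMDiffAt.comp (g := f) (f := (Prod.fst : V × V → V)) (x, x) hf contDiffAt_fst.contMDiffAt
  have h2 : ContMDiffAt 𝓘(ℝ, V × V) 𝓘(ℝ, E) 2 (fun p : V × V => f p.2) (x, x) :=
    ContMDiffAt.comp (g := f) (f := (Prod.snd : V × V → V)) (x, x) hf contDiffAt_snd.contMDiffAt
  exact (ContMDiffAt.comp (g := (chart : G → E)) (x, x)
    (contMDiffAt_chart (mul_inv_cancel (f x))) (h1.mul h2.inv)).contDiffAt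

theorem eventually_contMDiffAt {f : V → G} {x : V}
    (hf : ContMDiffAt 𝓘(ℝ, V) 𝓘(ℝ, E) 2 f x) :
    ∀ᶠ y in nhds x, ContMDiffAt 𝓘(ℝ, V) 𝓘(ℝ, E) 1 f y := by
  have : IsManifold 𝓘(ℝ, E) ∞ G := inferInstance
  have : IsManifold 𝓘(ℝ, E) 2 G := IsManifold.of_le (n := ∞) ENat.LEInfty.out
  exact ((contMDiffAt_iff_contMDiffAt_nhds (by simp)).1 hf).mono
    fun y hy => hy.of_le one_le_two

theorem differentiableAt_rightDeriv {f : V → G} {x : V}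
    (hf : ContMDiffAt 𝓘(ℝ, V) 𝓘(ℝ, E) 2 f x) :
    DifferentiableAt ℝ (rightDeriv f : V → V →L[ℝ] E) x := by
  have hΦ := contDiffAt_chart_mul_inv_prod hf
  set Φ : V × V → E := fun p => chart (f p.1 * (f p.2)⁻¹) with hΦdef
  have hdiag : DifferentiableAt ℝ (fun y : V => (y, y)) x := by fun_prop
  have h1 : DifferentiableAt ℝ (fun y => (fderiv ℝ Φ (y, y)).comp
      (ContinuousLinearMap.inl ℝ V V)) x := by
    have h2 : DifferentiableAt ℝ (fun y => fderiv ℝ Φ (y, y)) x :=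
      DifferentiableAt.comp (g := fderiv ℝ Φ) (f := fun y : V => (y, y)) x
        ((hΦ.fderiv_right (m := 1) (by rw [one_add_one_eq_two])).differentiableAt one_ne_zero)
        hdiag
    exact h2.clm_comp (differentiableAt_const _)
  refine h1.congr_of_eventuallyEq ?_
  have h3 : ∀ᶠ y in nhds x, DifferentiableAt ℝ Φ (y, y) :=
    hdiag.continuousAt.eventually (((hΦ.of_le one_le_two).eventually (by simp)).mono
      fun p hp => hp.differentiableAt one_ne_zero)
  filter_upwards [h3, eventually_contMDiffAt hf] with y hy hfy
  rw [rightDeriv_eq_fderiv hfy]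
  exact (HasFDerivAt.comp (g := Φ) (f := fun z : V => (z, y)) y hy.hasFDerivAt
    ((hasFDerivAt_id y).prodMk (hasFDerivAt_const y y))).fderiv

/-- Differentiate `f z f(x)⁻¹ = (f z f(y)⁻¹)(f y f(x)⁻¹)` at `z = y`. The right side involves the
moving trivialization, the left side a fixed one. -/
theorem eventually_fderiv_localMul_rightDeriv {f : V → G} {x : V}
    (hf : ContMDiffAt 𝓘(ℝ, V) 𝓘(ℝ, E) 2 f x) :
    ∀ᶠ y in nhds x, ∀ δ : V,
      fderiv ℝ (localMul E G) (origin E G, chart (f y * (f x)⁻¹)) (rightDeriv f y δ, 0) =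
        fderiv ℝ (fun z => chart (E := E) (f z * (f x)⁻¹)) y δ := by
  have hS := contDiffAt_chart_mul_inv (n := 2) (by exact_mod_cast hf)
  have hSx : chart (f x * (f x)⁻¹) = origin E G := by rw [mul_inv_cancel, chart_one]
  have hm : ∀ᶠ y in nhds x, DifferentiableAt ℝ (localMul E G)
      (origin E G, chart (f y * (f x)⁻¹)) := by
    have hc : ContinuousAt (fun y => (origin E G, chart (E := E) (f y * (f x)⁻¹))) x :=
      continuousAt_const.prodMk hS.continuousAt
    rw [ContinuousAt, hSx] at hc
    exact hc.eventually <| eventually_differentiableAt_localMul E G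
  have hinv : ∀ᶠ y in nhds x, chartInv G (chart (E := E) (f y * (f x)⁻¹)) = f y * (f x)⁻¹ :=
    (contMDiffAt_mul_const (n := 2) (by exact_mod_cast hf) (f x)⁻¹).continuousAt.eventually
      (eventually_chartInv_chart (mul_inv_cancel _))
  filter_upwards [hm, hinv, eventually_contMDiffAt hf] with y hmy hinvy hfy δ
  have hfy' : ContMDiffAt 𝓘(ℝ, V) 𝓘(ℝ, E) ((1 : ℕ) : ℕ∞ω) f y := by exact_mod_cast hfy
  have h1 : HasFDerivAt (fun z => chart (E := E) (f z * (f y)⁻¹)) (rightDeriv f y) y := by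
    rw [rightDeriv_eq_fderiv hfy]
    exact ((contDiffAt_chart_mul_inv hfy').differentiableAt one_ne_zero).hasFDerivAt
  have hy1 : chart (f y * (f y)⁻¹) = origin E G := by rw [mul_inv_cancel, chart_one]
  have h2 := hasFDerivAt_comp_prodMk (m := localMul E G) (by rw [hy1]; exact hmy) h1
    (hasFDerivAt_const (chart (E := E) (f y * (f x)⁻¹)) y)
  have h3 : (fun z => chart (E := E) (f z * (f x)⁻¹)) =ᶠ[nhds y]
      fun z => localMul E G (chart (f z * (f y)⁻¹), chart (f y * (f x)⁻¹)) := by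
    filter_upwards [(contMDiffAt_mul_const hfy' (f y)⁻¹).continuousAt.eventually
      (eventually_chartInv_chart (E := E) (mul_inv_cancel _))] with z hz
    rw [localMul_chart hz hinvy]
    simp [mul_assoc]
  rw [(h2.congr_of_eventuallyEq h3).fderiv, hy1]
  simp

/-- The Maurer–Cartan equation for the right-trivialized derivative. -/
theorem fderiv_rightDeriv_sub {f : V → G} {x : V} (hf : ContMDiffAt 𝓘(ℝ, V) 𝓘(ℝ, E) 2 f x)
    (ε δ : V) :
    fderiv ℝ (rightDeriv f : V → V →L[ℝ] E) x ε δ - fderiv ℝ (rightDeriv f) x δ ε =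
      bracket G (rightDeriv f x ε) (rightDeriv f x δ) := by
  have hS : ContDiffAt ℝ 2 (fun z => chart (E := E) (f z * (f x)⁻¹)) x := by
    exact_mod_cast contDiffAt_chart_mul_inv (n := 2) (by exact_mod_cast hf)
  have hR := (differentiableAt_rightDeriv hf).hasFDerivAt
  have hfx := (eventually_contMDiffAt hf).self_of_nhds
  have hSx : chart (f x * (f x)⁻¹) = origin E G := by rw [mul_inv_cancel, chart_one]
  -- The previous identity differentiated at `x`. Its right side is symmetric in `ε` and `δ`, so
  -- antisymmetrizing leaves only mixed terms of `mulHessian`, that is, the bracket.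
  have key : ∀ ε δ : V, fderiv ℝ (rightDeriv f : V → V →L[ℝ] E) x ε δ +
      mulHessian E G (0, rightDeriv f x ε) (rightDeriv f x δ, 0) =
      fderiv ℝ (fderiv ℝ (fun z => chart (E := E) (f z * (f x)⁻¹))) x ε δ := by
    intro ε δ
    have h1 := hasFDerivAt_fderiv_localMul_apply (G := G) (hasFDerivAt_const (origin E G) x)
      (hS.differentiableAt two_ne_zero).hasFDerivAt
      ((hR.clm_apply (hasFDerivAt_const δ x)).prodMk (hasFDerivAt_const (0 : E) x)) rfl hSx
    have h2 := (((hS.fderiv_right (m := 1) (by rw [one_add_one_eq_two])).differentiableAt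
      one_ne_zero).hasFDerivAt).clm_apply (hasFDerivAt_const δ x)
    have h3 := h1.unique (h2.congr_of_eventuallyEq
      ((eventually_fderiv_localMul_rightDeriv hf).mono fun y hy => hy δ))
    have h4 := congrArg (fun L : V →L[ℝ] E => L ε) h3
    simp [rightDeriv_eq_fderiv hfx] at h4
    rw [rightDeriv_eq_fderiv hfx, ← h4]
    have := fderiv_localMul_inl (G := G) (fderiv ℝ (rightDeriv f : V → V →L[ℝ] E) x ε δ)
    simp [this]
  have hsymm := hS.isSymmSndFDerivAt (by rw [minSmoothness_of_isRCLikeNormedField]) ε δ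
  rw [bracket_eq_mulHessian, mulHessian_symm (_, 0), mulHessian_symm (_, 0)]
  have h1 := key ε δ
  have h2 := key δ ε
  rw [hsymm] at h1
  rw [← h2] at h1
  rw [sub_eq_sub_iff_add_eq_add, h1, add_comm]

end RightDerivative

/-! ### The adjoint representation and its derivative -/

section Adjoint

variable {E : Type*} [NormedAddCommGroup E] [NormedSpace ℝ E]
variable {G : Type*} [TopologicalSpace G] [ChartedSpace E G] [Group G] [LieGroup 𝓘(ℝ, E) ∞ G]
variable {V : Type*} [NormedAddCommGroup V] [NormedSpace ℝ V]

theorem contMDiff_conj (a : G) :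
    ContMDiff 𝓘(ℝ, E) 𝓘(ℝ, E) 1 (fun x : G => a * x * a⁻¹) :=
  have : LieGroup 𝓘(ℝ, E) 1 G := LieGroup.of_le (n := ∞) ENat.LEInfty.out
  (contMDiff_const.mul contMDiff_id).mul contMDiff_const

omit [LieGroup 𝓘(ℝ, E) ∞ G] in
theorem Ad_one : (Ad (1 : G) : E →L[ℝ] E) = ContinuousLinearMap.id ℝ E := by
  have h : (fun x : G => 1 * x * 1⁻¹) = id := by ext x; simp
  unfold Ad
  rw [h]
  exact mfderiv_id

theorem Ad_mul (a b : G) : (Ad (a * b) : E →L[ℝ] E) = (Ad a).comp (Ad b) := by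
  have h : (fun x : G => a * b * x * (a * b)⁻¹) =
      (fun x : G => a * x * a⁻¹) ∘ fun x => b * x * b⁻¹ := by
    ext x
    simp [mul_assoc]
  have h1 := (contMDiff_conj (E := E) a).mdifferentiableAt (x := b * 1 * b⁻¹) one_ne_zero
  have h2 := (contMDiff_conj (E := E) b).mdifferentiableAt (x := 1) one_ne_zero
  unfold Ad
  rw [h]
  refine (mfderiv_comp (I' := 𝓘(ℝ, E)) 1 h1 h2).trans ?_
  have : b * 1 * b⁻¹ = 1 := by simp
  rw [this]
  rfl

theorem Ad_inv_apply_Ad_apply (a : G) (η : E) : Ad a⁻¹ (Ad a η) = η := by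
  have h := Ad_mul (E := E) a⁻¹ a
  rw [inv_mul_cancel, Ad_one] at h
  exact (congrArg (fun L : E →L[ℝ] E => L η) h).symm

theorem Ad_apply_Ad_inv_apply (a : G) (η : E) : Ad a (Ad a⁻¹ η) = η := by
  simpa using Ad_inv_apply_Ad_apply a⁻¹ η

theorem AdStar_mul (a b : G) (μ : StrongDual ℝ E) :
    AdStar (a * b) μ = AdStar b (AdStar a μ) := by
  simp only [AdStar, Ad_mul, ContinuousLinearMap.comp_assoc]

omit [LieGroup 𝓘(ℝ, E) ∞ G] in
theorem AdStar_one (μ : StrongDual ℝ E) : AdStar (1 : G) μ = μ := by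
  simp only [AdStar, Ad_one, ContinuousLinearMap.comp_id]

variable (E G) in
/-- Conjugation in the preferred chart at the identity. -/
def localConj (p : E × E) : E := chart (chartInv G p.1 * chartInv G p.2 * (chartInv G p.1)⁻¹)

variable (E G) in
theorem contDiffAt_localConj : ContDiffAt ℝ 2 (localConj E G) (origin E G, origin E G) := by
  have : LieGroup 𝓘(ℝ, E) 2 G := LieGroup.of_le (n := ∞) ENat.LEInfty.out
  have h1 : ContMDiffAt 𝓘(ℝ, E × E) 𝓘(ℝ, E) 2 (fun p : E × E => chartInv G p.1)
      (origin E G, origin E G) :=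
    ContMDiffAt.comp (x := ((origin E G, origin E G) : E × E)) (g := chartInv G)
      (f := (Prod.fst : E × E → E)) ((contMDiffAt_chartInv E G).of_le ENat.LEInfty.out)
      contDiffAt_fst.contMDiffAt
  have h2 : ContMDiffAt 𝓘(ℝ, E × E) 𝓘(ℝ, E) 2 (fun p : E × E => chartInv G p.2)
      (origin E G, origin E G) :=
    ContMDiffAt.comp (x := ((origin E G, origin E G) : E × E)) (g := chartInv G)
      (f := (Prod.snd : E × E → E)) ((contMDiffAt_chartInv E G).of_le ENat.LEInfty.out)
      contDiffAt_snd.contMDiffAt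
  exact (ContMDiffAt.comp (g := (chart : G → E)) (origin E G, origin E G)
    (contMDiffAt_chart (by simp)) ((h1.mul h2).mul h1.inv)).contDiffAt

variable (E G) in
theorem eventually_differentiableAt_localConj :
    ∀ᶠ w in nhds (origin E G), DifferentiableAt ℝ (localConj E G) (w, origin E G) := by
  have hc : ContinuousAt (fun w => (w, origin E G)) (origin E G) := by fun_prop
  exact hc.eventually ((((contDiffAt_localConj E G).of_le one_le_two).eventually (by simp)).mono
    fun p hp => hp.differentiableAt one_ne_zero)

theorem Ad_chartInv_eq {w : E} (hw : DifferentiableAt ℝ (localConj E G) (w, origin E G)) :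
    (Ad (chartInv G w) : E →L[ℝ] E) =
      (fderiv ℝ (localConj E G) (w, origin E G)).comp (ContinuousLinearMap.inr ℝ E E) := by
  refine (mfderiv_eq_fderiv_chart_chartInv (contMDiff_conj _).contMDiffAt (by simp)).trans ?_
  exact (hasFDerivAt_comp_prodMk hw (hasFDerivAt_const w (origin E G))
    (hasFDerivAt_id (origin E G))).fderiv

variable (E G) in
theorem contDiffAt_Ad_chartInv :
    ContDiffAt ℝ 1 (fun w => (Ad (chartInv G w) : E →L[ℝ] E)) (origin E G) := by
  have h : ContDiffAt ℝ 1 (fun w => fderiv ℝ (localConj E G) (w, origin E G)) (origin E G) :=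
    ContDiffAt.comp (g := fderiv ℝ (localConj E G)) (f := fun w => (w, origin E G)) (origin E G)
      ((contDiffAt_localConj E G).fderiv_right (by rw [one_add_one_eq_two])) (by fun_prop)
  refine
    (h.clm_comp (contDiffAt_const (c := ContinuousLinearMap.inr ℝ E E))).congr_of_eventuallyEq ?_
  filter_upwards [eventually_differentiableAt_localConj E G] with w hw
  exact Ad_chartInv_eq hw

/-- Differentiate `w z = (w z w⁻¹) w` at `z = 1`: `Ad` converts between the left and right
trivializations. -/
theorem eventually_fderiv_localMul_Ad :
    ∀ᶠ w in nhds (origin E G), ∀ η : E,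
      fderiv ℝ (localMul E G) (origin E G, w) (Ad (chartInv G w) η, 0) =
        fderiv ℝ (localMul E G) (w, origin E G) (0, η) := by
  have hc1 : ContinuousAt (fun w => (origin E G, w)) (origin E G) := by fun_prop
  have hc2 : ContinuousAt (fun w => (w, origin E G)) (origin E G) := by fun_prop
  filter_upwards [hc1.eventually (eventually_differentiableAt_localMul E G),
    hc2.eventually (eventually_differentiableAt_localMul E G),
    eventually_differentiableAt_localConj E G] with w h1 h2 h3 η
  have hC := hasFDerivAt_comp_prodMk (a := fun _ => w) (b := fun z => z) h3
    (hasFDerivAt_const w (origin E G)) (hasFDerivAt_id (origin E G))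
  have hC0 : localConj E G (w, origin E G) = origin E G := by simp [localConj, chart_one]
  have hL := hasFDerivAt_comp_prodMk (m := localMul E G) (a := fun z => localConj E G (w, z))
    (b := fun _ => w) (by rw [hC0]; exact h1) hC (hasFDerivAt_const w (origin E G))
  have hR := hasFDerivAt_comp_prodMk (a := fun _ => w) (b := fun z => z) h2
    (hasFDerivAt_const w (origin E G)) (hasFDerivAt_id (origin E G))
  have heq : (fun z => localMul E G (w, z)) =ᶠ[nhds (origin E G)]
      fun z => localMul E G (localConj E G (w, z), w) := by
    have hcont : ContinuousAt (fun z => chartInv G w * chartInv G z * (chartInv G w)⁻¹)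
        (origin E G) :=
      (contMDiff_conj (E := E) (chartInv G w)).continuous.continuousAt.comp
        (contMDiffAt_chartInv E G).continuousAt
    filter_upwards [hcont.eventually (eventually_chartInv_chart (E := E) (by simp))] with z hz
    simp [localMul, localConj, hz]
  have h := hR.unique (hL.congr_of_eventuallyEq heq)
  have h4 := congrArg (fun L : E →L[ℝ] E => L η) h
  rw [Ad_chartInv_eq h3]
  simpa [hC0] using h4.symm

/-- Differentiate `eventually_fderiv_localMul_Ad` at the identity. The two sides yield the two mixed
second derivatives whose difference is the bracket. -/
theorem fderiv_Ad_chartInv_apply (ζ η : E) :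
    fderiv ℝ (fun w => (Ad (chartInv G w) : E →L[ℝ] E)) (origin E G) ζ η = bracket G ζ η := by
  have hA := ((contDiffAt_Ad_chartInv E G).differentiableAt one_ne_zero).hasFDerivAt
  have h1 := hasFDerivAt_fderiv_localMul_apply (G := G)
    (hasFDerivAt_const (origin E G) (origin E G)) (hasFDerivAt_id (origin E G))
    ((hA.clm_apply (hasFDerivAt_const η (origin E G))).prodMk
      (hasFDerivAt_const (0 : E) (origin E G))) rfl rfl
  have h2 := hasFDerivAt_fderiv_localMul_apply (G := G)
    (hasFDerivAt_id (origin E G)) (hasFDerivAt_const (origin E G) (origin E G))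
    (hasFDerivAt_const ((0 : E), η) (origin E G)) rfl rfl
  have h3 := h1.unique (h2.congr_of_eventuallyEq
    (eventually_fderiv_localMul_Ad.mono fun w hw => hw η))
  have h4 := congrArg (fun L : E →L[ℝ] E => L ζ) h3
  have h5 := fderiv_localMul_inl (G := G)
    (fderiv ℝ (fun w => (Ad (chartInv G w) : E →L[ℝ] E)) (origin E G) ζ η)
  simp [Ad_one, h5] at h4
  rw [bracket_eq_mulHessian, ← h4, mulHessian_symm (0, ζ)]
  abel

-- Since `Ad` is a homomorphism, its regularity and derivative at `b` reduce to those at the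
-- identity.
variable (E) in
theorem eventually_Ad_eq (b : G) :
    ∀ᶠ x in nhds b, (Ad x : E →L[ℝ] E) =
      (Ad (chartInv G (chart (E := E) (x * b⁻¹)))).comp (Ad b) := by
  have hc : ContinuousAt (fun x => x * b⁻¹) b :=
    (contMDiff_mul_right (I := 𝓘(ℝ, E)) (n := ∞) (a := b⁻¹)).continuous.continuousAt
  filter_upwards [hc.eventually (eventually_chartInv_chart (E := E) (mul_inv_cancel b))] with x hx
  rw [hx, ← Ad_mul (E := E)]
  simp

theorem contMDiff_Ad : ContMDiff 𝓘(ℝ, E) 𝓘(ℝ, E →L[ℝ] E) 1 (Ad : G → E →L[ℝ] E) := by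
  intro b
  refine ContMDiffAt.congr_of_eventuallyEq ?_ (eventually_Ad_eq E b)
  have h1 : ContMDiffAt 𝓘(ℝ, E) 𝓘(ℝ, E) 1 (fun x : G => chart (E := E) (x * b⁻¹)) b :=
    ContMDiffAt.comp (g := (chart : G → E)) (f := fun x => x * b⁻¹) b
      (contMDiffAt_chart (mul_inv_cancel b))
      ((contMDiff_mul_right (I := 𝓘(ℝ, E)) (n := ∞) (a := b⁻¹)).contMDiffAt.of_le
        ENat.LEInfty.out)
  have h2 : ContDiffAt ℝ 1 (fun w : E => (Ad (chartInv G w) : E →L[ℝ] E).comp (Ad b))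
      (chart (b * b⁻¹)) := by
    rw [mul_inv_cancel, chart_one]
    exact (contDiffAt_Ad_chartInv E G).clm_comp contDiffAt_const
  exact ContMDiffAt.comp b h2.contMDiffAt h1

theorem hasFDerivAt_Ad_comp_apply {f : V → G} {x : V} (hf : ContMDiffAt 𝓘(ℝ, V) 𝓘(ℝ, E) 1 f x) :
    ∃ L : V →L[ℝ] E →L[ℝ] E, HasFDerivAt (fun y => (Ad (f y) : E →L[ℝ] E)) L x ∧
      ∀ δ η, L δ η = bracket G (rightDeriv f x δ) (Ad (f x) η) := by
  have hS : HasFDerivAt (fun z => chart (E := E) (f z * (f x)⁻¹)) (rightDeriv f x) x := by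
    rw [rightDeriv_eq_fderiv hf]
    exact ((contDiffAt_chart_mul_inv (n := 1) (by exact_mod_cast hf)).differentiableAt
      one_ne_zero).hasFDerivAt
  have hA := ((contDiffAt_Ad_chartInv E G).differentiableAt one_ne_zero).hasFDerivAt
  have hSx : chart (f x * (f x)⁻¹) = origin E G := by rw [mul_inv_cancel, chart_one]
  rw [← hSx] at hA
  have h := (HasFDerivAt.comp x hA hS).clm_comp (hasFDerivAt_const (Ad (f x)) x)
  refine ⟨_, h.congr_of_eventuallyEq (hf.continuousAt.eventually (eventually_Ad_eq E (f x))), ?_⟩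
  intro δ η
  simp [chart_one, fderiv_Ad_chartInv_apply]

/-- Differentiate `Ad (a w a⁻¹) ∘ Ad a = Ad a ∘ Ad w` at `w = 1`. -/
theorem Ad_bracket (a : G) (ξ η : E) :
    Ad a (bracket G ξ η) = bracket G (Ad a ξ) (Ad a η) := by
  have h1 : ContMDiffAt 𝓘(ℝ, E) 𝓘(ℝ, E) 1 (chartInv G) (origin E G) :=
    (contMDiffAt_chartInv E G).of_le ENat.LEInfty.out
  have h2 : ContMDiffAt 𝓘(ℝ, E) 𝓘(ℝ, E) 1 (fun w => a * chartInv G w * a⁻¹) (origin E G) :=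
    ContMDiffAt.comp (g := fun x => a * x * a⁻¹) (origin E G) (contMDiff_conj a).contMDiffAt h1
  obtain ⟨L, hL, hLe⟩ := hasFDerivAt_Ad_comp_apply h2
  have hr : rightDeriv (fun w => a * chartInv G w * a⁻¹) (origin E G) = (Ad a : E →L[ℝ] E) := by
    rw [rightDeriv_eq_fderiv h2]
    refine Eq.trans ?_
      (mfderiv_eq_fderiv_chart_chartInv (contMDiff_conj (E := E) a).contMDiffAt (by simp)).symm
    simp
  have hA := ((contDiffAt_Ad_chartInv E G).differentiableAt one_ne_zero).hasFDerivAt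
  have h3 := ((hasFDerivAt_const (Ad a : E →L[ℝ] E) (origin E G)).clm_comp hA)
  have heq : (fun w : E => (Ad (a * chartInv G w * a⁻¹) : E →L[ℝ] E).comp (Ad a)) =
      fun w => (Ad a : E →L[ℝ] E).comp (Ad (chartInv G w)) := by
    ext w
    rw [← Ad_mul (E := E), ← Ad_mul (E := E)]
    simp
  have h4 := hL.clm_comp (hasFDerivAt_const (Ad a : E →L[ℝ] E) (origin E G))
  rw [heq] at h4
  have h5 := congrArg (fun L : E →L[ℝ] E →L[ℝ] E => L ξ η) (h4.unique h3)
  simp [hLe, hr, Ad_one, fderiv_Ad_chartInv_apply] at h5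
  exact h5.symm

end Adjoint

/-! ### One step of the method preserves the pairing -/

section Step

variable {E : Type*} [NormedAddCommGroup E] [NormedSpace ℝ E] [FiniteDimensional ℝ E]
variable {G : Type*} [TopologicalSpace G] [ChartedSpace E G] [Group G] [LieGroup 𝓘(ℝ, E) ∞ G]
variable {V : Type*} [NormedAddCommGroup V] [NormedSpace ℝ V]

variable (G) in
theorem add_bracket (ξ η ζ : E) :
    bracket G (ξ + η) ζ = bracket G ξ ζ + bracket G η ζ := by
  rw [← bracket_skew, bracket_add, neg_add, bracket_skew, bracket_skew]

omit [FiniteDimensional ℝ E] in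
theorem rightDeriv_comp {σ : E → G} {X : V → E} {p : V}
    (hσ : ContMDiffAt 𝓘(ℝ, E) 𝓘(ℝ, E) 1 σ (X p)) (hX : ContDiffAt ℝ 1 X p) :
    (rightDeriv (fun q => σ (X q)) p : V →L[ℝ] E) =
      (rightDeriv σ (X p)).comp (fderiv ℝ X p) := by
  rw [rightDeriv_eq_fderiv hσ,
    rightDeriv_eq_fderiv (f := fun q => σ (X q)) (hσ.comp p hX.contMDiffAt)]
  exact fderiv_comp p
    ((contDiffAt_chart_mul_inv (n := 1) (by exact_mod_cast hσ)).differentiableAt one_ne_zero)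
    (hX.differentiableAt one_ne_zero)

/-- Differentiating `Ad_f` adds the right derivative of `f` to the generator `ξ`; moving the sum
past the coadjoint action rotates it by `Ad_{f⁻¹}`. -/
theorem hasFDerivAt_AdStar {f : V → G} {ν : V → StrongDual ℝ E} {p : V}
    {ν' : V →L[ℝ] StrongDual ℝ E} (hf : ContMDiffAt 𝓘(ℝ, V) 𝓘(ℝ, E) 1 f p)
    (hν : HasFDerivAt ν ν' p) :
    ∃ L : V →L[ℝ] StrongDual ℝ E, HasFDerivAt (fun q => AdStar (f q) (ν q)) L p ∧
      ∀ (u : V) (ξ : E), ν' u = adStar G ξ (ν p) →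
        L u = adStar G (Ad (f p)⁻¹ (ξ + rightDeriv f p u)) (AdStar (f p) (ν p)) := by
  obtain ⟨A, hA, hAe⟩ := hasFDerivAt_Ad_comp_apply hf
  refine ⟨_, hν.clm_comp hA, fun u ξ hu => ?_⟩
  ext η
  simp only [adStar_apply, AdStar, ContinuousLinearMap.comp_apply, Ad_bracket,
    Ad_apply_Ad_inv_apply, add_bracket, map_add]
  simp [hAe, hu, add_comm]

/-- The symplectic core: `S` generates the step, and the extra terms of the pairing amount to the
antisymmetric part of `⟨M' u, X' v⟩`. -/
theorem pairing_step {X : V → E} {ν M : V → StrongDual ℝ E} {σ : E → G}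
    {S : StrongDual ℝ E → ℝ} {p : V} {ν' M' : V →L[ℝ] StrongDual ℝ E}
    (hX : ContDiffAt ℝ 1 X p) (hν : HasFDerivAt ν ν' p) (hM : HasFDerivAt M M' p)
    (hσ : ContMDiffAt 𝓘(ℝ, E) 𝓘(ℝ, E) 2 σ (X p)) (hS : ContDiffAt ℝ 2 S (M p))
    (hMν : ∀ᶠ q in nhds p, ∀ δ : E, 2 * M q δ = ν q (rightDeriv σ (X q) δ))
    (hXS : ∀ᶠ q in nhds p, ∀ κ : StrongDual ℝ E, 2 * κ (X q) = fderiv ℝ S (M q) κ)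
    {u v : V} {ξ η : E} (hu : ν' u = adStar G ξ (ν p)) (hv : ν' v = adStar G η (ν p)) :
    ν p (bracket G (ξ + rightDeriv (fun q => σ (X q)) p u)
      (η + rightDeriv (fun q => σ (X q)) p v)) = ν p (bracket G ξ η) := by
  have hX' := (hX.differentiableAt one_ne_zero).hasFDerivAt
  have hR := HasFDerivAt.comp p (differentiableAt_rightDeriv hσ).hasFDerivAt hX'
  have h1 : ∀ (w : V) (δ : E), 2 * M' w δ = ν' w (rightDeriv σ (X p) δ) +
      ν p (fderiv ℝ (rightDeriv σ : E → E →L[ℝ] E) (X p) (fderiv ℝ X p w) δ) := by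
    intro w δ
    have hl := (hM.clm_apply (hasFDerivAt_const δ p)).const_mul 2
    have hr := hν.clm_apply (hR.clm_apply (hasFDerivAt_const δ p))
    have := congrArg (fun L : V →L[ℝ] ℝ => L w)
      (hl.unique (hr.congr_of_eventuallyEq (hMν.mono fun q hq => hq δ)))
    simp at this
    rw [this, add_comm]
  have h2 : ∀ (w : V) (κ : StrongDual ℝ E),
      2 * κ (fderiv ℝ X p w) = fderiv ℝ (fderiv ℝ S) (M p) (M' w) κ := by
    intro w κ
    have hl := (κ.hasFDerivAt.comp p hX').const_mul 2
    have hD := HasFDerivAt.comp p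
      ((hS.fderiv_right (m := 1) (by rw [one_add_one_eq_two])).differentiableAt
        one_ne_zero).hasFDerivAt hM
    have hr := hD.clm_apply (hasFDerivAt_const κ p)
    have := congrArg (fun L : V →L[ℝ] ℝ => L w)
      (hl.unique (hr.congr_of_eventuallyEq (hXS.mono fun q hq => hq κ)))
    simpa using this
  -- Twice either side is `D²S(M p)` evaluated on `M' u` and `M' v`.
  have hsymm : M' u (fderiv ℝ X p v) = M' v (fderiv ℝ X p u) := by
    have h3 := h2 v (M' u)
    have h4 := h2 u (M' v)
    rw [hS.isSymmSndFDerivAt (by rw [minSmoothness_of_isRCLikeNormedField]) (M' u) (M' v)] at h4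
    linarith
  have hmc := congrArg (ν p) (fderiv_rightDeriv_sub hσ (fderiv ℝ X p u) (fderiv ℝ X p v))
  have h5 := h1 u (fderiv ℝ X p v)
  have h6 := h1 v (fderiv ℝ X p u)
  rw [hu, adStar_apply] at h5
  rw [hv, adStar_apply, ← bracket_skew] at h6
  rw [map_sub] at hmc
  rw [map_neg] at h6
  rw [rightDeriv_comp (hσ.of_le one_le_two) hX]
  simp only [add_bracket, bracket_add, map_add, ContinuousLinearMap.comp_apply]
  linarith

end Step

/-! ### Linear algebra: from symplectic on orbits to Poisson -/

section LinearAlgebra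

variable {E : Type*} [NormedAddCommGroup E] [NormedSpace ℝ E] [FiniteDimensional ℝ E]
variable {G : Type*} [TopologicalSpace G] [ChartedSpace E G] [Group G] [LieGroup 𝓘(ℝ, E) ∞ G]

variable (G) in
/-- The Poisson tensor `ξ ↦ ad*_ξ ν` as a linear map. -/
def poissonMap (ν : StrongDual ℝ E) : E →ₗ[ℝ] StrongDual ℝ E where
  toFun ξ := adStar G ξ ν
  map_add' ξ η := by ext ζ; simp [add_bracket]
  map_smul' c ξ := by
    ext ζ
    simp only [adStar_apply, RingHom.id_apply, smul_apply]
    rw [← bracket_skew, bracket_smul, ← smul_neg, bracket_skew, map_smul]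

/-- A linear map `T` is symplectic from the coadjoint orbit of `ν` to that of `ν'`. -/
def IsOrbitSymplectic (G : Type*) [TopologicalSpace G] [ChartedSpace E G] [Group G]
    [LieGroup 𝓘(ℝ, E) ∞ G] (T : StrongDual ℝ E →L[ℝ] StrongDual ℝ E)
    (ν ν' : StrongDual ℝ E) : Prop :=
  ∀ ξ η : E, ∃ ξ' η' : E, T (adStar G ξ ν) = adStar G ξ' ν' ∧ T (adStar G η ν) = adStar G η' ν' ∧
    ν' (bracket G ξ' η') = ν (bracket G ξ η)

/-- The Kirillov–Kostant–Souriau pairing sees generators only through the tangent vectors they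
define. -/
theorem apply_bracket_congr {ν : StrongDual ℝ E} {ξ ξ' η η' : E}
    (hξ : adStar G ξ ν = adStar G ξ' ν) (hη : adStar G η ν = adStar G η' ν) :
    ν (bracket G ξ η) = ν (bracket G ξ' η') := by
  rw [← adStar_apply, hξ, adStar_apply, ← bracket_skew, map_neg, ← adStar_apply, hη, adStar_apply,
    ← map_neg, bracket_skew]

theorem IsOrbitSymplectic.apply_bracket_eq {T : StrongDual ℝ E →L[ℝ] StrongDual ℝ E}
    {ν ν' : StrongDual ℝ E} (h : IsOrbitSymplectic G T ν ν') {ξ η ξ' η' : E}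
    (hξ : T (adStar G ξ ν) = adStar G ξ' ν') (hη : T (adStar G η ν) = adStar G η' ν') :
    ν' (bracket G ξ' η') = ν (bracket G ξ η) := by
  obtain ⟨ξ₁, η₁, h1, h2, h3⟩ := h ξ η
  rw [← h3]
  exact apply_bracket_congr (hξ.symm.trans h1) (hη.symm.trans h2)

/-- Because `Ad_a` preserves brackets, `Ad*_a` sends `ad*_{Ad_a ξ} ν` to `ad*_ξ (Ad*_a ν)`, so it
covers the new tangent space. Applying this to `a⁻¹` gives equality. -/
theorem finrank_range_poissonMap_AdStar_le (a : G) (ν : StrongDual ℝ E) :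
    Module.finrank ℝ (poissonMap G (AdStar a ν)).range ≤
      Module.finrank ℝ (poissonMap G ν).range := by
  let L : StrongDual ℝ E →ₗ[ℝ] StrongDual ℝ E :=
    { toFun := AdStar a
      map_add' := fun μ ν => ContinuousLinearMap.add_comp μ ν _
      map_smul' := fun c μ => ContinuousLinearMap.smul_comp c μ _ }
  have h : (poissonMap G (AdStar a ν)).range ≤ (poissonMap G ν).range.map L := by
    rintro _ ⟨ξ, rfl⟩
    refine ⟨poissonMap G ν (Ad a ξ), ⟨Ad a ξ, rfl⟩, ?_⟩
    ext η
    exact congrArg ν (Ad_bracket a ξ η).symm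
  exact (Submodule.finrank_mono h).trans (Submodule.finrank_map_le L _)

theorem finrank_range_poissonMap_AdStar (a : G) (ν : StrongDual ℝ E) :
    Module.finrank ℝ (poissonMap G (AdStar a ν)).range =
      Module.finrank ℝ (poissonMap G ν).range := by
  refine le_antisymm (finrank_range_poissonMap_AdStar_le a ν) ?_
  have h := finrank_range_poissonMap_AdStar_le a⁻¹ (AdStar a ν)
  rwa [← AdStar_mul, mul_inv_cancel, AdStar_one] at h

theorem exists_apply_eq_of_finrank_eq {F : Type*} [AddCommGroup F] [Module ℝ F]
    [FiniteDimensional ℝ F] {T : F →ₗ[ℝ] F} {p q : Submodule ℝ F}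
    (hpq : Module.finrank ℝ p = Module.finrank ℝ q) (hmaps : ∀ v ∈ p, T v ∈ q)
    (hinj : ∀ v ∈ p, T v = 0 → v = 0) : ∀ w ∈ q, ∃ v ∈ p, T v = w := by
  intro w hw
  have hR : Function.Injective (T.restrict hmaps) := by
    rw [injective_iff_map_eq_zero]
    rintro ⟨v, hv⟩ h
    exact Subtype.ext (hinj v hv (congrArg Subtype.val h))
  obtain ⟨⟨v, hv⟩, h⟩ :=
    (LinearMap.injective_iff_surjective_of_finrank_eq_finrank hpq).1 hR ⟨w, hw⟩
  exact ⟨v, hv, congrArg Subtype.val h⟩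

/-- Nondegeneracy of the form makes `T` injective on the tangent space; equal dimensions along the
orbit make it onto. -/
theorem IsOrbitSymplectic.exists_preimage {T : StrongDual ℝ E →L[ℝ] StrongDual ℝ E}
    {ν : StrongDual ℝ E} {a : G} (h : IsOrbitSymplectic G T ν (AdStar a ν)) (η : E) :
    ∃ ξ : E, T (adStar G ξ ν) = adStar G η (AdStar a ν) := by
  have hmaps : ∀ w ∈ (poissonMap G ν).range, T w ∈ (poissonMap G (AdStar a ν)).range := by
    rintro _ ⟨ξ, rfl⟩
    obtain ⟨ξ', _, h1, -⟩ := h ξ ξ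
    exact ⟨ξ', h1.symm⟩
  have hinj : ∀ w ∈ (poissonMap G ν).range, T w = 0 → w = 0 := by
    rintro _ ⟨ξ, rfl⟩ h0
    ext η
    obtain ⟨_, η', -, h2, -⟩ := h ξ η
    have h3 : T (adStar G ξ ν) = adStar G 0 (AdStar a ν) :=
      h0.trans (map_zero (poissonMap G (AdStar a ν))).symm
    have h4 := h.apply_bracket_eq h3 h2
    have h5 : AdStar a ν (bracket G 0 η') = 0 :=
      congrArg (fun κ : StrongDual ℝ E => κ η') (map_zero (poissonMap G (AdStar a ν)))
    rw [h5] at h4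
    exact h4.symm
  obtain ⟨_, ⟨ξ, rfl⟩, hξ⟩ := exists_apply_eq_of_finrank_eq (T := T.toLinearMap)
    (finrank_range_poissonMap_AdStar a ν).symm hmaps hinj _ ⟨η, rfl⟩
  exact ⟨ξ, hξ⟩

/-- `X'` and `Y'` are the transposes of `T` applied to `X` and `Y`. A preimage `η` of the tangent
vector generated by `Y` generates the same tangent vector at `ν` as `Y'` does. -/
theorem IsOrbitSymplectic.apply_bracket_transpose {T : StrongDual ℝ E →L[ℝ] StrongDual ℝ E}
    {ν : StrongDual ℝ E} {a : G} (h : IsOrbitSymplectic G T ν (AdStar a ν)) {X Y X' Y' : E}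
    (hX : ∀ κ : StrongDual ℝ E, κ X' = T κ X) (hY : ∀ κ : StrongDual ℝ E, κ Y' = T κ Y) :
    ν (bracket G X' Y') = AdStar a ν (bracket G X Y) := by
  obtain ⟨η, hη⟩ := h.exists_preimage Y
  have h1 : AdStar a ν (bracket G X Y) = ν (bracket G X' η) := by
    rw [← bracket_skew, map_neg, ← adStar_apply, ← hη, ← hX, adStar_apply, ← map_neg, bracket_skew]
  rw [h1]
  refine apply_bracket_congr rfl ?_
  ext ξ
  obtain ⟨ξ', _, h2, -⟩ := h ξ ξ
  rw [adStar_apply, adStar_apply, ← bracket_skew, ← bracket_skew G η, map_neg, map_neg, neg_inj,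
    ← h.apply_bracket_eq h2 hη, ← adStar_apply, ← adStar_apply, hY, h2]

end LinearAlgebra

/-! ### Right derivative of a product -/

section RightDerivMul

variable {E : Type*} [NormedAddCommGroup E] [NormedSpace ℝ E]
variable {G : Type*} [TopologicalSpace G] [ChartedSpace E G] [Group G] [LieGroup 𝓘(ℝ, E) ∞ G]
variable {V : Type*} [NormedAddCommGroup V] [NormedSpace ℝ V]

theorem hasFDerivAt_chart_mul_inv {f : V → G} {x : V} (hf : ContMDiffAt 𝓘(ℝ, V) 𝓘(ℝ, E) 1 f x) :
    HasFDerivAt (fun z => chart (E := E) (f z * (f x)⁻¹)) (rightDeriv f x) x := by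
  rw [rightDeriv_eq_fderiv hf]
  exact ((contDiffAt_chart_mul_inv (n := 1) (by exact_mod_cast hf)).differentiableAt
    one_ne_zero).hasFDerivAt

theorem eventually_chartInv_chart_mul_inv {f : V → G} {x : V}
    (hf : ContMDiffAt 𝓘(ℝ, V) 𝓘(ℝ, E) 1 f x) :
    ∀ᶠ z in nhds x, chartInv G (chart (E := E) (f z * (f x)⁻¹)) = f z * (f x)⁻¹ :=
  (contMDiffAt_mul_const (n := 1) (by exact_mod_cast hf) (f x)⁻¹).continuousAt.eventually
    (eventually_chartInv_chart (mul_inv_cancel _))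

theorem hasFDerivAt_chart_conj (a : G) :
    HasFDerivAt (fun w : E => chart (E := E) (a * chartInv G w * a⁻¹)) (Ad a) (origin E G) := by
  have h1 : ContMDiffAt 𝓘(ℝ, E) 𝓘(ℝ, E) 1 (fun w => a * chartInv G w * a⁻¹) (origin E G) :=
    ContMDiffAt.comp (g := fun x => a * x * a⁻¹) (origin E G) (contMDiff_conj a).contMDiffAt
      ((contMDiffAt_chartInv E G).of_le ENat.LEInfty.out)
  have h2 : ContMDiffAt 𝓘(ℝ, E) 𝓘(ℝ, E) 1 (fun w => chart (E := E) (a * chartInv G w * a⁻¹))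
      (origin E G) := ContMDiffAt.comp (origin E G) (contMDiffAt_chart (by simp)) h1
  have h3 : (Ad a : E →L[ℝ] E) = _ :=
    mfderiv_eq_fderiv_chart_chartInv (contMDiff_conj (E := E) a).contMDiffAt (by simp)
  rw [h3]
  exact (h2.contDiffAt.differentiableAt one_ne_zero).hasFDerivAt

/-- Translated to the identity, the product factors as `f z f(x)⁻¹` times the `f(x)`-conjugate of `g
z g(x)⁻¹`. Both factors equal `1` at `x`, where the derivative of the multiplication is addition. -/
theorem rightDeriv_mul {f g : V → G} {x : V} (hf : ContMDiffAt 𝓘(ℝ, V) 𝓘(ℝ, E) 1 f x)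
    (hg : ContMDiffAt 𝓘(ℝ, V) 𝓘(ℝ, E) 1 g x) :
    (rightDeriv (fun z => f z * g z) x : V →L[ℝ] E) =
      rightDeriv f x + (Ad (f x)).comp (rightDeriv g x) := by
  have : LieGroup 𝓘(ℝ, E) 1 G := LieGroup.of_le (n := ∞) ENat.LEInfty.out
  have hgx : chart (g x * (g x)⁻¹) = origin E G := by rw [mul_inv_cancel, chart_one]
  have hA := hasFDerivAt_chart_conj (E := E) (f x)
  rw [← hgx] at hA
  have hconj : HasFDerivAt
      (fun z => chart (E := E) (f x * chartInv G (chart (E := E) (g z * (g x)⁻¹)) * (f x)⁻¹))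
      ((Ad (f x)).comp (rightDeriv g x)) x :=
    HasFDerivAt.comp (g := fun w => chart (E := E) (f x * chartInv G w * (f x)⁻¹))
      (f := fun z => chart (E := E) (g z * (g x)⁻¹)) x hA (hasFDerivAt_chart_mul_inv hg)
  have h := hasFDerivAt_comp_prodMk (m := localMul E G)
    (by simpa [chart_one] using (eventually_differentiableAt_localMul E G).self_of_nhds)
    (hasFDerivAt_chart_mul_inv hf) hconj
  have heq : (fun z => chart (E := E) (f z * g z * (f x * g x)⁻¹)) =ᶠ[nhds x] fun z =>
      localMul E G (chart (f z * (f x)⁻¹),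
        chart (E := E) (f x * chartInv G (chart (E := E) (g z * (g x)⁻¹)) * (f x)⁻¹)) := by
    have hc : ContinuousAt (fun z => f x * (g z * (g x)⁻¹) * (f x)⁻¹) x :=
      (contMDiff_conj (E := E) (f x)).continuous.continuousAt.comp
        (contMDiffAt_mul_const (n := 1) (by exact_mod_cast hg) (g x)⁻¹).continuousAt
    filter_upwards [eventually_chartInv_chart_mul_inv hf, eventually_chartInv_chart_mul_inv hg,
      hc.eventually (eventually_chartInv_chart (E := E) (by simp))] with z h1 h2 h3
    rw [h2, localMul_chart h1 h3]
    congr 1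
    group
  rw [rightDeriv_eq_fderiv (f := fun z => f z * g z) (hf.mul hg),
    (h.congr_of_eventuallyEq heq).fderiv]
  ext δ
  have h1 := fderiv_localMul_inl (E := E) (G := G) (rightDeriv f x δ)
  have h2 := fderiv_localMul_inr (E := E) (G := G) (Ad (f x) (rightDeriv g x δ : E))
  have h3 : (((rightDeriv f x δ : E), Ad (f x) (rightDeriv g x δ : E)) : E × E) =
      (rightDeriv f x δ, 0) + (0, Ad (f x) (rightDeriv g x δ : E)) := by simp
  simp only [ContinuousLinearMap.comp_apply, ContinuousLinearMap.prod_apply, mul_inv_cancel,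
    mul_one, chartInv_origin, chart_one, add_apply]
  rw [h3, map_add, h1, h2]

end RightDerivMul

/-! ### Retraction maps and their squares -/

section RetractionFacts

variable {E : Type*} [NormedAddCommGroup E] [NormedSpace ℝ E]
variable {G : Type*} [TopologicalSpace G] [ChartedSpace E G] [Group G]

namespace Retraction

variable (τ : Retraction E G)

/-- The square of a retraction map. -/
def square (x : E) : G := τ.toFun x * τ.toFun x

variable {τ}

theorem contMDiffAt_toFun {x : E} (hx : x ∈ τ.source) :
    ContMDiffAt 𝓘(ℝ, E) 𝓘(ℝ, E) ∞ τ.toFun x :=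
  τ.contMDiffOn_toFun.contMDiffAt (τ.open_source.mem_nhds hx)

theorem contMDiffAt_invFun {g : G} (hg : g ∈ τ.target) :
    ContMDiffAt 𝓘(ℝ, E) 𝓘(ℝ, E) ∞ τ.invFun g :=
  τ.contMDiffOn_invFun.contMDiffAt (τ.open_target.mem_nhds hg)

variable [LieGroup 𝓘(ℝ, E) ∞ G]

theorem contMDiffAt_square {x : E} (hx : x ∈ τ.source) :
    ContMDiffAt 𝓘(ℝ, E) 𝓘(ℝ, E) ∞ τ.square x :=
  (contMDiffAt_toFun hx).mul (contMDiffAt_toFun hx)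

/-- The chain rule for `τ⁻¹(τ(z) τ(x)⁻¹ τ(x)) = z`. It recovers `μ̃` from `ν̃`. -/
theorem dInv_rightDeriv {x : E} (hx : x ∈ τ.source) (δ : E) :
    τ.dInv x (rightDeriv τ.toFun x δ) = δ := by
  have hg : HasMFDerivAt 𝓘(ℝ, E) 𝓘(ℝ, E) (fun z => τ.toFun z * (τ.toFun x)⁻¹) x
      (rightDeriv τ.toFun x : E →L[ℝ] E) :=
    ((contMDiffAt_mul_const (n := 1) ((contMDiffAt_toFun hx).of_le ENat.LEInfty.out)
      _).mdifferentiableAt (by simp)).hasMFDerivAt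
  have hr : HasMFDerivAt 𝓘(ℝ, E) 𝓘(ℝ, E) (fun y : G => y * τ.toFun x)
      (τ.toFun x * (τ.toFun x)⁻¹)
      (mfderiv 𝓘(ℝ, E) 𝓘(ℝ, E) (fun y : G => y * τ.toFun x) 1) := by
    rw [mul_inv_cancel]
    exact (mdifferentiableAt_mul_right _ _).hasMFDerivAt
  have hi : HasMFDerivAt 𝓘(ℝ, E) 𝓘(ℝ, E) τ.invFun
      (τ.toFun x * (τ.toFun x)⁻¹ * τ.toFun x)
      (mfderiv 𝓘(ℝ, E) 𝓘(ℝ, E) τ.invFun (τ.toFun x)) := by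
    rw [inv_mul_cancel_right]
    exact ((contMDiffAt_invFun (τ.map_source' hx)).mdifferentiableAt (by simp)).hasMFDerivAt
  obtain ⟨L, hL, hLd⟩ : ∃ L : E →L[ℝ] E, L δ = τ.dInv x (rightDeriv τ.toFun x δ) ∧
      HasFDerivAt (fun z => τ.invFun (τ.toFun z * (τ.toFun x)⁻¹ * τ.toFun x)) L x :=
    ⟨_, rfl, (HasMFDerivAt.comp (g := fun y : G => τ.invFun (y * τ.toFun x))
      (f := fun z => τ.toFun z * (τ.toFun x)⁻¹) x
      (HasMFDerivAt.comp (g := τ.invFun) (f := fun y : G => y * τ.toFun x)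
        (τ.toFun x * (τ.toFun x)⁻¹) hi hr) hg).hasFDerivAt⟩
  have heq : (fun z => τ.invFun (τ.toFun z * (τ.toFun x)⁻¹ * τ.toFun x)) =ᶠ[nhds x] id := by
    filter_upwards [τ.open_source.mem_nhds hx] with z hz
    simpa using τ.left_inv' hz
  rw [← hL, hLd.unique ((hasFDerivAt_id x).congr_of_eventuallyEq heq)]
  rfl

theorem rightDeriv_square {x : E} (hx : x ∈ τ.source) (δ : E) :
    (rightDeriv τ.square x δ : E) =
      rightDeriv τ.toFun x δ + Ad (τ.toFun x) (rightDeriv τ.toFun x δ) := by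
  have h : ContMDiffAt 𝓘(ℝ, E) 𝓘(ℝ, E) 1 τ.toFun x :=
    (contMDiffAt_toFun hx).of_le ENat.LEInfty.out
  exact congrArg (fun L : E →L[ℝ] E => L δ) (rightDeriv_mul h h)

end Retraction

end RetractionFacts

/-! ### Invariant Hamiltonians reduced to the dual of the Lie algebra -/

section ReducedHamiltonian

variable {E : Type*} [NormedAddCommGroup E] [NormedSpace ℝ E]
variable {G : Type*} [TopologicalSpace G] [ChartedSpace E G] [Group G]

/-- The restriction of a Hamiltonian on `T*G` to the dual of the Lie algebra. -/
def reduced (H : CotangentBundle E G → ℝ) (μ : StrongDual ℝ E) : ℝ := H ⟨1, μ⟩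

theorem trivialized_eq_reduced {H : CotangentBundle E G → ℝ} (hH : IsLeftInvariant H) (g : G)
    (μ : StrongDual ℝ E) : trivialized H g μ = reduced H μ := by
  rw [reduced, ← hH g]
  let f : G → CotangentBundle E G := fun b => ⟨b, ContinuousLinearMap.comp (M₂ := E) μ
    (mfderiv 𝓘(ℝ, E) 𝓘(ℝ, E) (fun x : G => g⁻¹ * x) b)⟩
  -- The lift of `(1, μ)` by `g` sits over `g * 1`. Since the fibre depends on the base point, the
  -- whole point is transported through `f`.
  exact congrArg H (congrArg f (mul_one g)).symm

theorem gradGroup_eq_zero {H : CotangentBundle E G → ℝ} (hH : IsLeftInvariant H) (g : G)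
    (μ : StrongDual ℝ E) : gradGroup (trivialized H) g μ = 0 := by
  have h : (fun x : G => trivialized H x μ) = fun _ => reduced H μ :=
    funext fun x => trivialized_eq_reduced hH x μ
  unfold gradGroup
  rw [h]
  exact (congrArg (fun L : E →L[ℝ] ℝ => L.comp (mfderiv 𝓘(ℝ, E) 𝓘(ℝ, E) (fun x : G => g * x) 1))
    mfderiv_const).trans (ContinuousLinearMap.zero_comp _)

theorem apply_gradMomentum [FiniteDimensional ℝ E] {H : CotangentBundle E G → ℝ}
    (hH : IsLeftInvariant H) (g : G) (μ κ : StrongDual ℝ E) :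
    κ (gradMomentum (trivialized H) g μ) = fderiv ℝ (reduced H) μ κ := by
  have h : trivialized H g = reduced H := funext fun x => trivialized_eq_reduced hH g x
  rw [gradMomentum, h, apply_variationalDerivative]

/-- The fibre over the identity is included smoothly: in a trivialization the fibre coordinate is
linear, hence smooth in finite dimension. -/
theorem contDiff_reduced [FiniteDimensional ℝ E] [LieGroup 𝓘(ℝ, E) ∞ G]
    {H : CotangentBundle E G → ℝ}
    (hH : ContMDiff (𝓘(ℝ, E).prod 𝓘(ℝ, E →L[ℝ] ℝ)) 𝓘(ℝ, ℝ) ∞ H) : ContDiff ℝ ∞ (reduced H) := by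
  rw [← contMDiff_iff_contDiff]
  refine ContMDiff.comp (g := H) (f := fun μ : StrongDual ℝ E => (⟨1, μ⟩ : CotangentBundle E G))
    hH ?_
  intro μ
  rw [Bundle.contMDiffAt_totalSpace]
  refine ⟨contMDiffAt_const, ?_⟩
  let e := trivializationAt (E →L[ℝ] ℝ)
    (fun g : G => TangentSpace 𝓘(ℝ, E) g →L[ℝ] Bundle.Trivial G ℝ g) 1
  let L : StrongDual ℝ E →ₗ[ℝ] StrongDual ℝ E := e.linearMapAt ℝ 1
  have h : (fun μ : StrongDual ℝ E => (e (⟨1, μ⟩ : CotangentBundle E G)).2) = L :=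
    (e.coe_linearMapAt_of_mem (FiberBundle.mem_baseSet_trivializationAt' 1)).symm
  exact h ▸ L.toContinuousLinearMap.contDiff.contMDiff.contMDiffAt

end ReducedHamiltonian

/-! ### The scheme for invariant Hamiltonians -/

section SchemeFacts

variable {E : Type*} [NormedAddCommGroup E] [NormedSpace ℝ E] [FiniteDimensional ℝ E]
variable {G : Type*} [TopologicalSpace G] [ChartedSpace E G] [Group G]

/-- The reduced Hamiltonian increment `Δt h + ∑ i, ΔW i hᵢ` driving one step of the method. -/
def stepHamiltonian {N : ℕ} (H : CotangentBundle E G → ℝ) (Hn : Fin N → CotangentBundle E G → ℝ)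
    (Δt : ℝ) (ΔW : Fin N → ℝ) (μ : StrongDual ℝ E) : ℝ :=
  Δt * reduced H μ + ∑ i, ΔW i * reduced (Hn i) μ

/-- The momentum at the node `k`, transported from `μ` along the discrete curve. -/
def DiscreteCurve.nodeMomentum (c : DiscreteCurve E G) (μ : StrongDual ℝ E) (k : ℕ) :
    StrongDual ℝ E :=
  AdStar ((c.g 0)⁻¹ * c.g k) μ

variable [LieGroup 𝓘(ℝ, E) ∞ G]
variable {N : ℕ} {τ : Retraction E G} {H : CotangentBundle E G → ℝ}
  {Hn : Fin N → CotangentBundle E G → ℝ} {Δt : ℝ} {ΔW : ℕ → Fin N → ℝ} {K : ℕ}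

omit [FiniteDimensional ℝ E] [LieGroup 𝓘(ℝ, E) ∞ G] in
theorem contDiff_stepHamiltonian (hH : ContDiff ℝ ∞ (reduced H))
    (hHn : ∀ i, ContDiff ℝ ∞ (reduced (Hn i))) (w : Fin N → ℝ) :
    ContDiff ℝ ∞ (stepHamiltonian H Hn Δt w) :=
  (contDiff_const.mul hH).add (ContDiff.sum fun i _ => contDiff_const.mul (hHn i))

omit [FiniteDimensional ℝ E] [LieGroup 𝓘(ℝ, E) ∞ G] in
theorem fderiv_stepHamiltonian (hH : ContDiff ℝ ∞ (reduced H))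
    (hHn : ∀ i, ContDiff ℝ ∞ (reduced (Hn i))) (w : Fin N → ℝ) (μ κ : StrongDual ℝ E) :
    fderiv ℝ (stepHamiltonian H Hn Δt w) μ κ =
      Δt * fderiv ℝ (reduced H) μ κ + ∑ i, w i * fderiv ℝ (reduced (Hn i)) μ κ := by
  have h1 : HasFDerivAt (reduced H) (fderiv ℝ (reduced H) μ) μ :=
    ((hH.differentiable (by simp)) μ).hasFDerivAt
  have h2 : ∀ i ∈ Finset.univ, HasFDerivAt (fun ν => w i * reduced (Hn i) ν)
      (w i • fderiv ℝ (reduced (Hn i)) μ) μ := fun i _ =>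
    ((((hHn i).differentiable (by simp)) μ).hasFDerivAt).const_mul (w i)
  have h : HasFDerivAt (stepHamiltonian H Hn Δt w) _ μ :=
    (h1.const_mul Δt).add (HasFDerivAt.fun_sum h2)
  rw [h.fderiv]
  simp

namespace IsMidpointSolution

variable {c : DiscreteCurve E G} {k : ℕ}

omit [LieGroup 𝓘(ℝ, E) ∞ G] in
-- Both velocity equations have the same right side, and `τ⁻¹` is injective on its domain.
theorem inc₂_eq (hc : IsMidpointSolution τ H Hn Δt ΔW K c) (hΔt : Δt ≠ 0)
    (hk : k ∈ Finset.Icc 1 K) : c.inc₂ k = c.inc₁ k := by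
  have h := (hc.velocity₁ k hk).trans (hc.velocity₂ k hk).symm
  have h' : τ.invFun (c.inc₁ k) = τ.invFun (c.inc₂ k) :=
    smul_right_injective E (one_div_ne_zero hΔt) h
  rw [← τ.right_inv' (hc.inc₁_mem k hk), ← τ.right_inv' (hc.inc₂_mem k hk), h']

omit [LieGroup 𝓘(ℝ, E) ∞ G] in
theorem two_mul_apply_velocity (hc : IsMidpointSolution τ H Hn Δt ΔW K c) (hΔt : Δt ≠ 0)
    (hinv : IsLeftInvariant H) (hninv : ∀ i, IsLeftInvariant (Hn i)) (hk : k ∈ Finset.Icc 1 K)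
    (κ : StrongDual ℝ E) :
    2 * κ (τ.invFun (c.inc₁ k)) = Δt * fderiv ℝ (reduced H) (c.muMid k) κ +
      ∑ i, ΔW k i * fderiv ℝ (reduced (Hn i)) (c.muMid k) κ := by
  have h := congrArg κ (hc.velocity₁ k hk)
  simp only [map_smul, map_add, map_sum, smul_eq_mul, apply_gradMomentum hinv,
    apply_gradMomentum (hninv _)] at h
  have h2 : ∑ i, ΔW k i / Δt * fderiv ℝ (reduced (Hn i)) (c.muMid k) κ =
      (1 / Δt) * ∑ i, ΔW k i * fderiv ℝ (reduced (Hn i)) (c.muMid k) κ := by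
    rw [Finset.mul_sum]
    exact Finset.sum_congr rfl fun i _ => by ring
  rw [h2] at h
  field_simp at h
  linarith

omit [LieGroup 𝓘(ℝ, E) ∞ G] in
theorem nu₂_eq (hc : IsMidpointSolution τ H Hn Δt ΔW K c) (hΔt : Δt ≠ 0)
    (hinv : IsLeftInvariant H) (hninv : ∀ i, IsLeftInvariant (Hn i)) (hk : k ∈ Finset.Icc 1 K) :
    c.nu₂ τ k = AdStar (c.inc₁ k) (c.nu₁ τ k) := by
  have h := hc.momentum_mid k hk
  simp only [gradGroup_eq_zero hinv, gradGroup_eq_zero (hninv _), smul_zero,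
    Finset.sum_const_zero, add_zero] at h
  exact (sub_eq_zero.1 ((smul_eq_zero.1 h).resolve_left (one_div_ne_zero hΔt))).symm

omit [LieGroup 𝓘(ℝ, E) ∞ G] in
theorem nu₁_succ (hc : IsMidpointSolution τ H Hn Δt ΔW K c) (hΔt : Δt ≠ 0)
    (hk : k ∈ Finset.Ico 1 K) : c.nu₁ τ (k + 1) = AdStar (c.inc₂ k) (c.nu₂ τ k) :=
  (sub_eq_zero.1 ((smul_eq_zero.1 (hc.momentum_node k hk)).resolve_left
    (one_div_ne_zero hΔt))).symm

/-- Undoing `dInvStar` writes `μ̃¹` and `μ̃²` through `ν̃¹` and `Ad* ν̃¹`; their sum is the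
derivative of a square, which is why `τ²` governs the step. -/
theorem two_mul_muMid_apply (hc : IsMidpointSolution τ H Hn Δt ΔW K c) (hΔt : Δt ≠ 0)
    (hinv : IsLeftInvariant H) (hninv : ∀ i, IsLeftInvariant (Hn i)) (hk : k ∈ Finset.Icc 1 K)
    (δ : E) :
    2 * c.muMid k δ = c.nu₁ τ k (rightDeriv τ.square (τ.invFun (c.inc₁ k)) δ) := by
  have hx := τ.map_target' (hc.inc₁_mem k hk)
  have hτ : τ.toFun (τ.invFun (c.inc₁ k)) = c.inc₁ k := τ.right_inv' (hc.inc₁_mem k hk)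
  have h1 : c.nu₁ τ k (rightDeriv τ.toFun (τ.invFun (c.inc₁ k)) δ) = c.mu₁ k δ :=
    congrArg (c.mu₁ k) (Retraction.dInv_rightDeriv hx δ)
  have h2 : c.nu₂ τ k (rightDeriv τ.toFun (τ.invFun (c.inc₁ k)) δ) = c.mu₂ k δ := by
    rw [DiscreteCurve.nu₂, hc.inc₂_eq hΔt hk]
    exact congrArg (c.mu₂ k) (Retraction.dInv_rightDeriv hx δ)
  rw [hc.nu₂_eq hΔt hinv hninv hk] at h2
  rw [Retraction.rightDeriv_square hx, map_add, h1, hτ, DiscreteCurve.muMid]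
  refine Eq.trans ?_ (congrArg _ h2).symm
  simp only [smul_apply, add_apply, smul_eq_mul]
  ring

theorem nodeMomentum_succ (hc : IsMidpointSolution τ H Hn Δt ΔW K c) (hΔt : Δt ≠ 0)
    (hk : k + 1 ∈ Finset.Icc 1 K) (μ : StrongDual ℝ E) :
    c.nodeMomentum μ (k + 1) =
      AdStar (τ.square (τ.invFun (c.inc₁ (k + 1)))) (c.nodeMomentum μ k) := by
  have hτ : τ.toFun (τ.invFun (c.inc₁ (k + 1))) = c.inc₁ (k + 1) :=
    τ.right_inv' (hc.inc₁_mem _ hk)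
  rw [DiscreteCurve.nodeMomentum, DiscreteCurve.nodeMomentum, ← AdStar_mul, Retraction.square, hτ]
  congr 1
  -- Reading one of the two equal increments as the second half-step makes the product telescope to
  -- `g_k⁻¹ g_{k+1}`.
  nth_rw 2 [← hc.inc₂_eq hΔt hk]
  simp [DiscreteCurve.inc₁, DiscreteCurve.inc₂, mul_assoc]

theorem AdStar_inc₂_nu₂ (hc : IsMidpointSolution τ H Hn Δt ΔW K c) (hΔt : Δt ≠ 0)
    (hinv : IsLeftInvariant H) (hninv : ∀ i, IsLeftInvariant (Hn i))
    (hk : k + 1 ∈ Finset.Icc 1 K) {μ : StrongDual ℝ E}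
    (h : c.nu₁ τ (k + 1) = c.nodeMomentum μ k) :
    AdStar (c.inc₂ (k + 1)) (c.nu₂ τ (k + 1)) = c.nodeMomentum μ (k + 1) := by
  have hτ : τ.toFun (τ.invFun (c.inc₁ (k + 1))) = c.inc₁ (k + 1) :=
    τ.right_inv' (hc.inc₁_mem _ hk)
  rw [hc.nu₂_eq hΔt hinv hninv hk, h, hc.nodeMomentum_succ hΔt hk, hc.inc₂_eq hΔt hk,
    ← AdStar_mul, Retraction.square, hτ]

/-- The index shifts: `ν̃¹` of step `k + 1` lives at node `k`. The last node has no following step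
and is handled by `finalMomentum_eq`. -/
theorem nu₁_eq_nodeMomentum (hc : IsMidpointSolution τ H Hn Δt ΔW K c) (hΔt : Δt ≠ 0)
    (hinv : IsLeftInvariant H) (hninv : ∀ i, IsLeftInvariant (Hn i)) :
    ∀ k < K, c.nu₁ τ (k + 1) = c.nodeMomentum (c.initialMomentum τ) k := by
  intro k
  induction k with
  | zero =>
    intro _
    rw [DiscreteCurve.nodeMomentum, inv_mul_cancel, AdStar_one]
    rfl
  | succ k ih =>
    intro hk
    rw [hc.nu₁_succ hΔt (Finset.mem_Ico.2 ⟨by omega, hk⟩),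
      hc.AdStar_inc₂_nu₂ hΔt hinv hninv (Finset.mem_Icc.2 ⟨by omega, by omega⟩) (ih (by omega))]

theorem finalMomentum_eq (hc : IsMidpointSolution τ H Hn Δt ΔW K c) (hΔt : Δt ≠ 0)
    (hinv : IsLeftInvariant H) (hninv : ∀ i, IsLeftInvariant (Hn i)) (hK : 1 ≤ K) :
    c.finalMomentum τ K = c.nodeMomentum (c.initialMomentum τ) K := by
  obtain ⟨k, rfl⟩ : ∃ k, K = k + 1 := ⟨K - 1, by omega⟩
  exact hc.AdStar_inc₂_nu₂ hΔt hinv hninv (Finset.mem_Icc.2 ⟨by omega, le_rfl⟩)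
    (hc.nu₁_eq_nodeMomentum hΔt hinv hninv k (by omega))

end IsMidpointSolution

/-- Induction over the nodes, with `pairing_step` applied to the node momentum as a function of the
initial one. -/
theorem exists_hasFDerivAt_nodeMomentum {U : Set (StrongDual ℝ E)} (hU : IsOpen U)
    (hΔt : Δt ≠ 0) (hinv : IsLeftInvariant H) (hninv : ∀ i, IsLeftInvariant (Hn i))
    (hH : ContDiff ℝ ∞ (reduced H)) (hHn : ∀ i, ContDiff ℝ ∞ (reduced (Hn i)))
    {c : StrongDual ℝ E → DiscreteCurve E G}
    (hc : ∀ μ ∈ U, IsMidpointSolution τ H Hn Δt ΔW K (c μ) ∧ (c μ).initialMomentum τ = μ)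
    (hg : ∀ k ∈ Finset.Icc 0 K,
      ContMDiffOn 𝓘(ℝ, StrongDual ℝ E) 𝓘(ℝ, E) 1 (fun μ => (c μ).g k) U)
    (hm : ∀ k ∈ Finset.Icc 1 K,
      ContMDiffOn 𝓘(ℝ, StrongDual ℝ E) 𝓘(ℝ, E) 1 (fun μ => (c μ).gMid k) U ∧
      ContDiffOn ℝ 1 (fun μ => (c μ).mu₁ k) U ∧ ContDiffOn ℝ 1 (fun μ => (c μ).mu₂ k) U)
    {μ₀ : StrongDual ℝ E} (hμ₀ : μ₀ ∈ U) :
    ∀ k ≤ K, ∃ L : StrongDual ℝ E →L[ℝ] StrongDual ℝ E,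
      HasFDerivAt (fun μ => (c μ).nodeMomentum μ k) L μ₀ ∧
        IsOrbitSymplectic G L μ₀ ((c μ₀).nodeMomentum μ₀ k) := by
  have hUμ := hU.mem_nhds hμ₀
  have : LieGroup 𝓘(ℝ, E) 1 G := LieGroup.of_le (n := ∞) ENat.LEInfty.out
  intro k
  induction k with
  | zero =>
    intro _
    refine ⟨ContinuousLinearMap.id ℝ _, ?_, fun ξ η => ⟨ξ, η, ?_⟩⟩
    · simp only [DiscreteCurve.nodeMomentum, inv_mul_cancel, AdStar_one]
      exact hasFDerivAt_id μ₀
    · simp [DiscreteCurve.nodeMomentum, AdStar_one]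
  | succ k ih =>
    intro hk
    obtain ⟨L, hL, hsymp⟩ := ih (by omega)
    have hk1 : k + 1 ∈ Finset.Icc 1 K := Finset.mem_Icc.2 ⟨by omega, hk⟩
    have hx := τ.map_target' ((hc μ₀ hμ₀).1.inc₁_mem _ hk1)
    have hinc : ContMDiffAt 𝓘(ℝ, StrongDual ℝ E) 𝓘(ℝ, E) 1 (fun μ => (c μ).inc₁ (k + 1)) μ₀ :=
      ((hg k (Finset.mem_Icc.2 ⟨by omega, by omega⟩)).contMDiffAt hUμ).inv.mul
        ((hm _ hk1).1.contMDiffAt hUμ)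
    have hX : ContDiffAt ℝ 1 (fun μ => τ.invFun ((c μ).inc₁ (k + 1))) μ₀ :=
      (ContMDiffAt.comp (g := τ.invFun) (f := fun μ => (c μ).inc₁ (k + 1)) μ₀
        ((Retraction.contMDiffAt_invFun ((hc μ₀ hμ₀).1.inc₁_mem _ hk1)).of_le
          ENat.LEInfty.out) hinc).contDiffAt
    have hσ : ContMDiffAt 𝓘(ℝ, E) 𝓘(ℝ, E) 2 τ.square (τ.invFun ((c μ₀).inc₁ (k + 1))) :=
      (Retraction.contMDiffAt_square hx).of_le ENat.LEInfty.out
    have hM : DifferentiableAt ℝ (fun μ => (c μ).muMid (k + 1)) μ₀ :=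
      ((((hm _ hk1).2.1.contDiffAt hUμ).add ((hm _ hk1).2.2.contDiffAt hUμ)).differentiableAt
        one_ne_zero).const_smul (1 / 2 : ℝ)
    have hf : ContMDiffAt 𝓘(ℝ, StrongDual ℝ E) 𝓘(ℝ, E) 1
        (fun μ => τ.square (τ.invFun ((c μ).inc₁ (k + 1)))) μ₀ :=
      (hσ.of_le one_le_two).comp μ₀ hX.contMDiffAt
    obtain ⟨L', hL', hL'e⟩ := hasFDerivAt_AdStar hf hL
    refine ⟨L', hL'.congr_of_eventuallyEq ?_, fun ξ η => ?_⟩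
    · filter_upwards [hUμ] with μ hμ
      exact (hc μ hμ).1.nodeMomentum_succ hΔt hk1 μ
    · obtain ⟨ξ', η', hξ, hη, hpair⟩ := hsymp ξ η
      rw [(hc μ₀ hμ₀).1.nodeMomentum_succ hΔt hk1 μ₀]
      refine ⟨_, _, hL'e _ _ hξ, hL'e _ _ hη, ?_⟩
      have hstep := pairing_step hX hL hM.hasFDerivAt hσ
        (S := stepHamiltonian H Hn Δt (ΔW (k + 1)))
        ((contDiff_stepHamiltonian hH hHn _).contDiffAt.of_le ENat.LEInfty.out) ?_ ?_ hξ hη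
      -- The rotation `Ad_{f⁻¹}` of both generators cancels against the coadjoint action, leaving
      -- the pairing at node `k`.
      · rw [← hpair, ← hstep, ← Ad_bracket, AdStar, ContinuousLinearMap.comp_apply,
          Ad_apply_Ad_inv_apply]
      · filter_upwards [hUμ] with μ hμ δ
        obtain ⟨h1, h2⟩ := hc μ hμ
        rw [h1.two_mul_muMid_apply hΔt hinv hninv hk1,
          h1.nu₁_eq_nodeMomentum hΔt hinv hninv k (by omega), h2]
      · filter_upwards [hUμ] with μ hμ κ
        rw [(hc μ hμ).1.two_mul_apply_velocity hΔt hinv hninv hk1, fderiv_stepHamiltonian hH hHn]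

end SchemeFacts

/-! ### From the linearized statement to the two conclusions -/

section Conclusion

variable {E : Type*} [NormedAddCommGroup E] [NormedSpace ℝ E] [FiniteDimensional ℝ E]
variable {G : Type*} [TopologicalSpace G] [ChartedSpace E G] [Group G] [LieGroup 𝓘(ℝ, E) ∞ G]
variable {F : StrongDual ℝ E → StrongDual ℝ E} {U : Set (StrongDual ℝ E)}
  {γ : StrongDual ℝ E → G}

theorem kksForm_eq {ν : StrongDual ℝ E} {u v : orbitTangent G ν} {ξ η : E}
    (hu : u.1 = adStar G ξ ν) (hv : v.1 = adStar G η ν) :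
    kksForm G ν u v = -ν (bracket G ξ η) := by
  obtain ⟨u, hu'⟩ := u
  obtain ⟨v, hv'⟩ := v
  subst hu hv
  exact kksForm_adStar G ν ξ η

omit [FiniteDimensional ℝ E] in
theorem contDiffOn_of_eq_AdStar (hU : IsOpen U)
    (hγ : ContMDiffOn 𝓘(ℝ, StrongDual ℝ E) 𝓘(ℝ, E) 1 γ U)
    (hF : ∀ μ ∈ U, F μ = AdStar (γ μ) μ) : ContDiffOn ℝ 1 F U := by
  intro μ hμ
  have h : ContDiffAt ℝ 1 (fun ν => (Ad (γ ν) : E →L[ℝ] E)) μ :=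
    (ContMDiffAt.comp (g := (Ad : G → E →L[ℝ] E)) μ contMDiff_Ad.contMDiffAt
      (hγ.contMDiffAt (hU.mem_nhds hμ))).contDiffAt
  refine ContDiffAt.contDiffWithinAt
    ((contDiffAt_id.clm_comp h).congr_of_eventuallyEq ?_)
  filter_upwards [hU.mem_nhds hμ] with ν hν
  exact hF ν hν

theorem isPoissonOn_of_isOrbitSymplectic (hU : IsOpen U) (hF1 : ContDiffOn ℝ 1 F U)
    (hF : ∀ μ ∈ U, F μ = AdStar (γ μ) μ)
    (hs : ∀ μ ∈ U, IsOrbitSymplectic G (fderiv ℝ F μ) μ (F μ)) : IsPoissonOn G F U := by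
  intro f g hf hg μ hμ
  have hFd : DifferentiableAt ℝ F μ :=
    (hF1.contDiffAt (hU.mem_nhds hμ)).differentiableAt one_ne_zero
  -- The variational derivative of `f ∘ F` is the transpose of `DF` applied to that of `f`.
  have key : ∀ f : StrongDual ℝ E → ℝ, ContDiff ℝ 1 f → ∀ κ : StrongDual ℝ E,
      κ (variationalDerivative (f ∘ F) μ) =
        fderiv ℝ F μ κ (variationalDerivative f (F μ)) := by
    intro f hf κ
    rw [apply_variationalDerivative, apply_variationalDerivative,
      fderiv_comp μ ((hf.differentiable one_ne_zero) _) hFd]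
    rfl
  have h := hs μ hμ
  rw [lpBracket, lpBracket, neg_inj]
  rw [hF μ hμ] at h
  refine (h.apply_bracket_transpose (key f hf) (key g hg)).trans ?_
  rw [hF μ hμ]

theorem isSymplecticOnOrbit_of_isOrbitSymplectic (hU : IsOpen U)
    (hγ : ContMDiffOn 𝓘(ℝ, StrongDual ℝ E) 𝓘(ℝ, E) 1 γ U)
    (hF : ∀ μ ∈ U, F μ = AdStar (γ μ) μ)
    (hs : ∀ μ ∈ U, IsOrbitSymplectic G (fderiv ℝ F μ) μ (F μ)) (μ : StrongDual ℝ E) :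
    IsSymplecticOnOrbit G F U μ := by
  have : LieGroup 𝓘(ℝ, E) 1 G := LieGroup.of_le (n := ∞) ENat.LEInfty.out
  have htan : ∀ ν ∈ U ∩ coadjointOrbit G μ, ∀ u ∈ orbitTangent G ν,
      fderiv ℝ F ν u ∈ orbitTangent G (F ν) := by
    rintro ν ⟨hν, -⟩ _ ⟨ξ, rfl⟩
    obtain ⟨ξ', _, h, -⟩ := hs ν hν ξ ξ
    exact ⟨ξ', h.symm⟩
  refine ⟨?_, ?_, htan, ?_⟩
  · rintro _ ⟨hν, a, rfl⟩
    exact ⟨a * γ (AdStar a μ), (AdStar_mul a _ μ).trans (hF _ hν).symm⟩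
  · intro a ha
    have hAd : ContMDiff 𝓘(ℝ, E) 𝓘(ℝ, StrongDual ℝ E) 1 (fun x : G => AdStar x μ) := by
      have h : ContDiff ℝ 1 (fun T : E →L[ℝ] E => μ.comp T) := contDiff_const.clm_comp contDiff_id
      exact h.contMDiff.comp contMDiff_Ad
    -- The lift to `G` multiplies by `γ` on the right because `Ad*_{ab} = Ad*_b Ad*_a`.
    refine ⟨fun x => x * γ (AdStar x μ), ?_, ?_⟩
    · exact contMDiffAt_id.mul (ContMDiffAt.comp a (hγ.contMDiffAt (hU.mem_nhds ha))
        hAd.contMDiffAt)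
    · filter_upwards [hAd.continuous.continuousAt.preimage_mem_nhds (hU.mem_nhds ha)] with x hx
      rw [hF _ hx, AdStar_mul]
  · rintro ν hν ⟨_, ξ, rfl⟩ ⟨_, η, rfl⟩
    obtain ⟨ξ', η', hξ, hη, h⟩ := hs ν hν.1 ξ η
    rw [kksForm_eq (ξ := ξ') (η := η') hξ hη, h]
    exact (kksForm_adStar G ν ξ η).symm

end Conclusion

end LiePoisson

end

theorem proposition4p4
    {E : Type*} [NormedAddCommGroup E] [NormedSpace ℝ E] [FiniteDimensional ℝ E]
    {G : Type*} [TopologicalSpace G] [ChartedSpace E G] [Group G] [LieGroup 𝓘(ℝ, E) ∞ G]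
    (τ : LiePoisson.Retraction E G) {N : ℕ}
    (H : LiePoisson.CotangentBundle E G → ℝ) (Hn : Fin N → LiePoisson.CotangentBundle E G → ℝ)
    (hH : ContMDiff (𝓘(ℝ, E).prod 𝓘(ℝ, E →L[ℝ] ℝ)) 𝓘(ℝ, ℝ) ∞ H)
    (hHn : ∀ i, ContMDiff (𝓘(ℝ, E).prod 𝓘(ℝ, E →L[ℝ] ℝ)) 𝓘(ℝ, ℝ) ∞ (Hn i))
    (hinv : LiePoisson.IsLeftInvariant H) (hninv : ∀ i, LiePoisson.IsLeftInvariant (Hn i))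
    {Ω : Type*} (W : Fin N → ℝ≥0 → Ω → ℝ)
    (Δt : ℝ≥0) (hΔt : 0 < Δt) (K : ℕ) (hK : 1 ≤ K)
    (U : Ω → Set (StrongDual ℝ E)) (F : Ω → StrongDual ℝ E → StrongDual ℝ E)
    (w : Ω) (hU : IsOpen (U w))
    (hF : LiePoisson.IsReducedFlow τ H Hn Δt (LiePoisson.increment W Δt w) K (U w) (F w)) :
    ContDiffOn ℝ 1 (F w) (U w) ∧
      LiePoisson.IsPoissonOn G (F w) (U w) ∧
      ∀ μ : StrongDual ℝ E, LiePoisson.IsSymplecticOnOrbit G (F w) (U w) μ := by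
  have : LieGroup 𝓘(ℝ, E) 1 G := LieGroup.of_le (n := ∞) ENat.LEInfty.out
  have hΔt' : (Δt : ℝ) ≠ 0 := by exact_mod_cast hΔt.ne'
  obtain ⟨c, hc, hg, hm⟩ := hF
  have hγ : ContMDiffOn 𝓘(ℝ, StrongDual ℝ E) 𝓘(ℝ, E) 1
      (fun μ => ((c μ).g 0)⁻¹ * (c μ).g K) (U w) :=
    (hg 0 (by simp)).inv.mul (hg K (by simp))
  have hFγ : ∀ μ ∈ U w, F w μ = LiePoisson.AdStar (((c μ).g 0)⁻¹ * (c μ).g K) μ := by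
    intro μ hμ
    obtain ⟨h1, h2, h3⟩ := hc μ hμ
    rw [← h3, h1.finalMomentum_eq hΔt' hinv hninv hK, h2]
    rfl
  have hs : ∀ μ ∈ U w, LiePoisson.IsOrbitSymplectic G (fderiv ℝ (F w) μ) μ (F w μ) := by
    intro μ hμ
    obtain ⟨L, hL, hsymp⟩ := LiePoisson.exists_hasFDerivAt_nodeMomentum hU hΔt' hinv hninv
      (LiePoisson.contDiff_reduced hH) (fun i => LiePoisson.contDiff_reduced (hHn i))
      (fun μ hμ => ⟨(hc μ hμ).1, (hc μ hμ).2.1⟩) hg hm hμ K le_rfl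
    -- On the open set `U w`, the flow coincides with the node momentum at `K`, so `L` is its
    -- derivative.
    rw [(hL.congr_of_eventuallyEq (Filter.eventually_of_mem (hU.mem_nhds hμ) hFγ)).fderiv, hFγ μ hμ]
    exact hsymp
  have hF1 := LiePoisson.contDiffOn_of_eq_AdStar hU hγ hFγ
  exact ⟨hF1, LiePoisson.isPoissonOn_of_isOrbitSymplectic hU hF1 hFγ hs,
    LiePoisson.isSymplecticOnOrbit_of_isOrbitSymplectic hU hγ hFγ hs⟩
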